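/- **Setting.** Let $X\subset\mathbb R^d$ be a set of $n$ points and $\mathbf{MST}(X)$ the minimum Euclidean weight of a spanning tree of the complete graph on $X$. Let $\alpha=2^{2^g}$, $\beta$, $\Delta$ be powers of $2$ ($g\ge 0$ an integer), $H,h\ge 0$ integers, and fix constants $C,K_d,K_\alpha,K_H$ and $C_s\ge 1$. Assume: $d\le K_d\log n$; $(\log n)^C\le\beta$, $(\log n)^C\le\alpha/\beta$ and $\alpha\le(\log n)^{K_\alpha}$; $X\subset[0,\Delta]^d$; distinct points of $X$ are at distance at least $\alpha^{100}$ and at most $\alpha^H$; $2\Delta\le\alpha^{H+1}/\beta$; and $H\le K_H\log n/\log\log n$. All levels $t$ below are powers of $2$ with $1\le t\le\alpha^H$. *Grids.* Draw $a$ uniformly from $[0,\Delta)^d$. The grid of side $L$ has the cells $\prod_i[c_iL-a_i,(c_i+1)L-a_i)$, $c\in\mathbb Z^d$; $X_c$ denotes the set of points of $X$ in a cell $c$. *Spanners.* A $C_s$-approximate 2-hop spanner of length $t$ on a finite set $Y$ is a graph on $Y$ all of whose edges have length at most $C_st$ and in which any two distinct points of $Y$ at distance at most $t$ are joined by a path with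 at most two edges. For each $t$, let $k\ge 0$ be the integer with $\alpha^{k-1}<t\le\alpha^k$, let $\tilde G'_t$ be the union, over all cells $c$ of side $\alpha^{k+1}/\beta$, of an arbitrary $C_s$-approximate 2-hop spanner of length $t$ on $X_c$, and let $\tilde G_t=\bigcup_{t'\le t}\tilde G'_{t'}$. *Leader compression.* Given a graph $G$ on $X$ and a partition of $X$, each part having a leader in it ($\ell(x)$ is the leader of the part of $x$), one round is: each leader $z$ draws a fresh independent fair bit $b_z\in\{0,1\}$; each leader $z$ with $b_z=0$ for which there is an edge $xy$ of $G$ with $\ell(y)=z$ and $b_{\ell(x)}=1$ selects an arbitrary such edge (the round *produces* this edge), and its part is merged into the part of $\ell(x)$, with leader $\ell(x)$. A part is *incomplete* if an edge of $G$ leaves it. *Parts 1–2.* For $t=\alpha^k$, start with the partition of $X$ into the nonempty cells of side $\alpha^k/\beta$ with arbitrary leaders, run $h$ rounds of leader compression with respect to $\tilde G_t$, and merge those incomplete parts whose leaders lie in the same cell of side $\alpha^{k+1}/\beta$; the result is $\hat{\mathcal P}_t$. For the other $t$, let $v$ be the largest integer with $2^v\mid\log_2t$ and $\kappa=2^{2^v}$;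 start with $\hat{\mathcal P}_{t/\kappa}$ with arbitrary leaders, run $h$ rounds with respect to $\tilde G_t$, and merge those incomplete parts whose leaders lie in the same part of $\hat{\mathcal P}_{t\kappa}$; the result is $\hat{\mathcal P}_t$ (this is a recursion in decreasing order of $v$). *Part 3.* For $t\ge2$, start with $\hat{\mathcal P}_{t/2}$ with arbitrary leaders and run $h$ rounds with respect to $\tilde G_t$, with new bits. $\hat G_t$ consists of the edges produced in these rounds and, for each part of $\hat{\mathcal P}_t$, the edges of a star (with arbitrary center) on the final leaders of the points in that part. Put $\hat G_1=\emptyset$. **Lemma.** There is an absolute constant $C_0$, and for each $C_s$ a constant $M$ depending only on $C_s$, such that for all $C\ge C_0$ and all $K_d,K_\alpha,K_H$ there are $c_0$ and $n_0$ with the following property. In the setting above with $n\ge n_0$ and $h\ge c_0\log\log n$, for all spanners and all arbitrary choices (which may depend on $a$): for every $a\in[0,\Delta)^d$ and every outcome of the bits, $\bigcup_{t\le\alpha^H}\hat G_t$ is the edge set of a spanning tree of $X$; and the expectation of its Euclidean weight over $a$ and the bits is at most $M\cdot\mathbf{MST}(X)$. -/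

import Mathlib

open scoped BigOperators

noncomputable section

namespace EuclidMST

/-! ### Spanning trees and their weight -/

/-- Euclidean length of an edge of the complete graph on `X`. -/
def edgeLen {d : ℕ} {X : Finset (EuclideanSpace ℝ (Fin d))} : Sym2 X → ℝ :=
  Sym2.lift ⟨fun x y => dist (x : EuclideanSpace ℝ (Fin d)) y, fun _ _ => dist_comm _ _⟩

open Classical in
/-- Total Euclidean length of a set of edges on `X`. -/
def weight {d : ℕ} {X : Finset (EuclideanSpace ℝ (Fin d))} (E : Set (Sym2 X)) : ℝ :=
  ∑ e : Sym2 X, if e ∈ E then edgeLen e else 0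

/-- `E` is the edge set of a spanning tree of the complete graph on `V`. -/
def IsSpanningTree {V : Type*} (E : Set (Sym2 V)) : Prop :=
  ∃ T : SimpleGraph V, T.IsTree ∧ T.edgeSet = E

/-- The minimum weight of a spanning tree on `X`. -/
def mst {d : ℕ} (X : Finset (EuclideanSpace ℝ (Fin d))) : ℝ :=
  sInf (weight '' {E : Set (Sym2 X) | IsSpanningTree E})

/-! ### The shifted grids -/

/-- The shift: independent coordinates, each uniform on `[0, Δ)`. -/
def shiftLaw (d : ℕ) (Δ : ℝ) : MeasureTheory.Measure (Fin d → ℝ) :=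
  MeasureTheory.Measure.pi fun _ =>
    ProbabilityTheory.cond MeasureTheory.volume (Set.Ico (0 : ℝ) Δ)

/-- The index `c ∈ ℤ^d` of the cell `∏ i, [c i * L - a i, (c i + 1) * L - a i)` containing `x`. -/
def cellIdx {d : ℕ} (a : Fin d → ℝ) (L : ℝ) (x : EuclideanSpace ℝ (Fin d)) : Fin d → ℤ :=
  fun i => ⌊(x i + a i) / L⌋

/-- The partition of `X` into the nonempty cells of the grid of side `L`. -/
def cellPartition {d : ℕ} (X : Finset (EuclideanSpace ℝ (Fin d))) (a : Fin d → ℝ) (L : ℝ) :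
    Setoid X :=
  Setoid.ker fun x : X => cellIdx a L x

/-- The points of `X` in the cell with index `c`. -/
def cellPoints {d : ℕ} (X : Finset (EuclideanSpace ℝ (Fin d))) (a : Fin d → ℝ) (L : ℝ)
    (c : Fin d → ℤ) : Set X :=
  {x | cellIdx a L x = c}

/-! ### Parameters: `α = 2 ^ (2 ^ g)`, `β = 2 ^ b`, top level `α ^ H`, `h` rounds.
A level `t` that is a power of two is represented by its exponent `j`, so `t = 2 ^ j`. -/

structure Params where
  g : ℕ
  b : ℕ
  H : ℕ
  h : ℕ

namespace Params

def α (p : Params) : ℝ := 2 ^ (2 ^ p.g)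

def β (p : Params) : ℝ := 2 ^ p.b

/-- The exponent of the top level: `α ^ H = 2 ^ p.top`. -/
def top (p : Params) : ℕ := p.H * 2 ^ p.g

/-- The `k` with `α ^ (k - 1) < 2 ^ j ≤ α ^ k` (and `k = 0` for `j = 0`). -/
def idx (p : Params) (j : ℕ) : ℕ := (j + 2 ^ p.g - 1) / 2 ^ p.g

end Params

/-! ### Spanners -/

/-- `G` is a `C`-approximate two-hop Euclidean spanner of length `t` on the subset `Y` of `X`. -/
structure IsTwoHopSpanner {d : ℕ} {X : Finset (EuclideanSpace ℝ (Fin d))} (C t : ℝ)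
    (Y : Set X) (G : SimpleGraph X) : Prop where
  mem : ∀ p q, G.Adj p q → p ∈ Y ∧ q ∈ Y
  short : ∀ p q, G.Adj p q →
    dist (p : EuclideanSpace ℝ (Fin d)) (q : EuclideanSpace ℝ (Fin d)) ≤ C * t
  hop : ∀ p ∈ Y, ∀ q ∈ Y, p ≠ q →
    dist (p : EuclideanSpace ℝ (Fin d)) (q : EuclideanSpace ℝ (Fin d)) ≤ t →
    G.Adj p q ∨ ∃ r ∈ Y, G.Adj p r ∧ G.Adj r q

/-- The union, over the levels `t' = 2 ^ i ≤ 2 ^ j` and over all cells `c` of side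
`α ^ (k + 1) / β`, where `α ^ (k - 1) < t' ≤ α ^ k`, of the spanners of length `t'` on the
points in `c`. -/
def spannerGraph {d : ℕ} {X : Finset (EuclideanSpace ℝ (Fin d))} (p : Params)
    (sp : ℕ → Set X → SimpleGraph X) (a : Fin d → ℝ) (j : ℕ) : SimpleGraph X :=
  ⨆ i : ℕ, ⨆ _ : i ≤ j, ⨆ c : Fin d → ℤ,
    sp i (cellPoints X a (p.α ^ (p.idx i + 1) / p.β) c)

/-! ### Leader compression -/

/-- The two uses of leader compression at a level: building the partition, and generating
the edges. They use separate coins. -/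
inductive Phase where
  | components
  | edges
  deriving DecidableEq

instance : Fintype Phase where
  elems := {Phase.components, Phase.edges}
  complete := by
    intro x
    cases x <;> simp

/-- The messages `(x, y)` that may reach the leader `z`: the coin of `z` is `0`, `y` has leader
`z`, the leader of `x` has coin `1`, and `x`, `y` are adjacent in `G`. -/
def messages {V : Type*} (G : SimpleGraph V) (l : V → V) (coin : V → Bool) (z : V) :
    Set (V × V) :=
  {m | G.Adj m.1 m.2 ∧ l m.2 = z ∧ coin (l m.1) = true ∧ coin z = false}

/-- All the arbitrary choices of the algorithm: the initial leader of each component, the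
message that each leader selects, and the centers of the stars. The theorem quantifies over all
of them. -/
structure Choices (V : Type*) where
  /-- `leader s j P x`: leader, in phase `s` at level `j`, of the component of `x` in `P`. -/
  leader : Phase → ℕ → Setoid V → V → V
  leader_rel : ∀ s j (P : Setoid V) x, P x (leader s j P x)
  leader_eq : ∀ s j (P : Setoid V) x y, P x y → leader s j P x = leader s j P y
  /-- `message s j i G l coin z`: message selected by `z` in round `i` of phase `s` at level `j`,
  for the graph `G`, the leader map `l` and the coins `coin` of this round. -/
  message : Phase → ℕ → ℕ → SimpleGraph V → (V → V) → (V → Bool) → V → V × V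
  message_mem : ∀ s j i G l coin z, (messages G l coin z).Nonempty →
    message s j i G l coin z ∈ messages G l coin z
  /-- `center j P l x`: center of the star on the set of leaders `l y`, `y` in the component of
  `x` in `P`. -/
  center : ℕ → Setoid V → (V → V) → V → V
  center_mem : ∀ j (P : Setoid V) l x, ∃ y, P x y ∧ center j P l x = l y
  center_eq : ∀ j (P : Setoid V) l x y, P x y → center j P l x = center j P l y

open Classical in
/-- One round of leader compression: the new leader map. -/
def compress {V : Type*} (G : SimpleGraph V) (sel : V → V × V) (l : V → V) (coin : V → Bool) :
    V → V :=
  fun y => if (messages G l coin (l y)).Nonempty then l (sel (l y)).1 else l y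

/-- One round of leader compression: the edges produced. -/
def compressEdges {V : Type*} (G : SimpleGraph V) (sel : V → V × V) (l : V → V)
    (coin : V → Bool) : Set (Sym2 V) :=
  {e | ∃ z, (messages G l coin z).Nonempty ∧ e = s((sel z).1, (sel z).2)}

/-- The leader map after the given number of rounds, starting from the partition `P`. -/
def leaders {V : Type*} (ch : Choices V) (s : Phase) (j : ℕ) (G : SimpleGraph V)
    (coins : ℕ → V → Bool) (P : Setoid V) : ℕ → V → V
  | 0 => ch.leader s j P
  | i + 1 =>
    compress G (ch.message s j i G (leaders ch s j G coins P i) (coins i))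
      (leaders ch s j G coins P i) (coins i)

/-- The component with leader `z` is incomplete: some edge of `G` leaves it. -/
def Incomplete {V : Type*} (G : SimpleGraph V) (l : V → V) (z : V) : Prop :=
  ∃ x y, G.Adj x y ∧ l x ≠ l y ∧ l x = z

/-- Merge the incomplete components whose leaders lie in the same class of `R`. -/
def mergeIncomplete {V : Type*} (G : SimpleGraph V) (l : V → V) (R : Setoid V) : Setoid V where
  r x y := l x = l y ∨ (Incomplete G l (l x) ∧ Incomplete G l (l y) ∧ R (l x) (l y))
  iseqv :=
    { refl := fun _ => Or.inl rfl
      symm := by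
        rintro x y (h | ⟨h1, h2, h3⟩)
        · exact Or.inl h.symm
        · exact Or.inr ⟨h2, h1, R.symm' h3⟩
      trans := by
        rintro x y z (h | ⟨h1, h2, h3⟩) (k | ⟨k1, k2, k3⟩)
        · exact Or.inl (h.trans k)
        · exact Or.inr ⟨h ▸ k1, k2, h ▸ k3⟩
        · exact Or.inr ⟨h1, k ▸ h2, k ▸ h3⟩
        · exact Or.inr ⟨h1, k2, R.trans' h3 k3⟩ }

/-! ### The algorithm -/

/-- The fair coins: one for each phase, level, round and point. -/
abbrev Coins {d : ℕ} (X : Finset (EuclideanSpace ℝ (Fin d))) (p : Params) : Type :=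
  Phase × Fin (p.top + 1) × Fin p.h × X → Bool

/-- The coins of a phase at a level; only rounds `i < h` and levels `j ≤ top` are ever used. -/
def coinsAt {d : ℕ} {X : Finset (EuclideanSpace ℝ (Fin d))} {p : Params} (ω : Coins X p)
    (s : Phase) (j : ℕ) : ℕ → X → Bool :=
  fun i x => if hj : j < p.top + 1 then if hi : i < p.h then ω (s, ⟨j, hj⟩, ⟨i, hi⟩, x) else false
    else false

theorem pow_succ_dvd_sub_and_add {j : ℕ} (hj : j ≠ 0) :
    2 ^ (padicValNat 2 j + 1) ∣ j - 2 ^ padicValNat 2 j ∧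
      2 ^ (padicValNat 2 j + 1) ∣ j + 2 ^ padicValNat 2 j := by
  obtain ⟨m, hm⟩ := @pow_padicValNat_dvd 2 j
  have hodd : ¬ 2 ∣ m := by
    rintro ⟨r, rfl⟩
    refine pow_succ_padicValNat_not_dvd (p := 2) hj ⟨r, ?_⟩
    rw [pow_succ]
    conv_lhs => rw [hm]
    ring
  generalize padicValNat 2 j = v at *
  subst hm
  constructor
  · obtain ⟨r, hr⟩ : 2 ∣ m - 1 := by omega
    refine ⟨r, ?_⟩
    rw [pow_succ, mul_assoc, ← hr, Nat.mul_sub, mul_one]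
  · obtain ⟨r, hr⟩ : 2 ∣ m + 1 := by omega
    refine ⟨r, ?_⟩
    rw [pow_succ, mul_assoc, ← hr, mul_add, mul_one]

open Classical in
theorem rank_lt {g j i : ℕ} (hj : ¬ 2 ^ g ∣ j) (hi : 2 ^ (padicValNat 2 j + 1) ∣ i) :
    (if 2 ^ g ∣ i then 0 else g - padicValNat 2 i) <
      (if 2 ^ g ∣ j then 0 else g - padicValNat 2 j) := by
  have hv : padicValNat 2 j < g := by
    by_contra h
    exact hj ((pow_dvd_pow 2 (not_lt.mp h)).trans pow_padicValNat_dvd)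
  rw [if_neg hj]
  split_ifs with h
  · omega
  · have h0 : i ≠ 0 := by
      rintro rfl
      exact h (dvd_zero _)
    have := (padicValNat_dvd_iff_le h0).mp hi
    omega

/-- The partition at level `t = 2 ^ j`.
If `t = α ^ k`: start from the cells of side `α ^ k / β`, run `h` rounds of leader compression
with respect to the spanner graph at level `t`, and merge the incomplete components with leaders
in the same cell of side `α ^ (k + 1) / β`.
Otherwise, with `κ = 2 ^ (2 ^ v)` and `v` the 2-adic valuation of `log₂ t = j`: start from the
partition at level `t / κ`, run `h` rounds with respect to the spanner graph at level `t`, and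
merge the incomplete components with leaders in the same component at level `t * κ`. -/
def hatPartition {d : ℕ} {X : Finset (EuclideanSpace ℝ (Fin d))} (p : Params)
    (sp : ℕ → Set X → SimpleGraph X) (ch : Choices X) (a : Fin d → ℝ) (ω : Coins X p)
    (j : ℕ) : Setoid X :=
  if _hj : 2 ^ p.g ∣ j then
    mergeIncomplete (spannerGraph p sp a j)
      (leaders ch .components j (spannerGraph p sp a j) (coinsAt ω .components j)
        (cellPartition X a (p.α ^ (j / 2 ^ p.g) / p.β)) p.h)
      (cellPartition X a (p.α ^ (j / 2 ^ p.g + 1) / p.β))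
  else
    mergeIncomplete (spannerGraph p sp a j)
      (leaders ch .components j (spannerGraph p sp a j) (coinsAt ω .components j)
        (hatPartition p sp ch a ω (j - 2 ^ padicValNat 2 j)) p.h)
      (hatPartition p sp ch a ω (j + 2 ^ padicValNat 2 j))
termination_by if 2 ^ p.g ∣ j then 0 else p.g - padicValNat 2 j
decreasing_by
  · have h0 : j ≠ 0 := by
      rintro rfl
      exact _hj (dvd_zero _)
    convert rank_lt _hj (pow_succ_dvd_sub_and_add h0).1
  · have h0 : j ≠ 0 := by
      rintro rfl
      exact _hj (dvd_zero _)
    convert rank_lt _hj (pow_succ_dvd_sub_and_add h0).2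

/-- The leader map after `i` rounds of the edge phase at level `2 ^ j`, which starts from the
partition at level `2 ^ (j - 1)`. -/
def edgeLeaders {d : ℕ} {X : Finset (EuclideanSpace ℝ (Fin d))} (p : Params)
    (sp : ℕ → Set X → SimpleGraph X) (ch : Choices X) (a : Fin d → ℝ) (ω : Coins X p)
    (j i : ℕ) : X → X :=
  leaders ch .edges j (spannerGraph p sp a j) (coinsAt ω .edges j)
    (hatPartition p sp ch a ω (j - 1)) i

/-- The edges generated at level `2 ^ j`, `1 ≤ j`: those of the `h` rounds of leader compression,
and a star on the remaining leaders in each component of the partition at level `2 ^ j`. -/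
def levelEdges {d : ℕ} {X : Finset (EuclideanSpace ℝ (Fin d))} (p : Params)
    (sp : ℕ → Set X → SimpleGraph X) (ch : Choices X) (a : Fin d → ℝ) (ω : Coins X p)
    (j : ℕ) : Set (Sym2 X) :=
  (⋃ i : Fin p.h,
    compressEdges (spannerGraph p sp a j)
      (ch.message .edges j i (spannerGraph p sp a j) (edgeLeaders p sp ch a ω j i)
        (coinsAt ω .edges j i))
      (edgeLeaders p sp ch a ω j i) (coinsAt ω .edges j i)) ∪
  {e | ∃ x : X,
    edgeLeaders p sp ch a ω j p.h x ≠
      ch.center j (hatPartition p sp ch a ω j) (edgeLeaders p sp ch a ω j p.h) x ∧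
    e = s(edgeLeaders p sp ch a ω j p.h x,
      ch.center j (hatPartition p sp ch a ω j) (edgeLeaders p sp ch a ω j p.h) x)}

/-- The output: the union of the edge sets of all levels `2, 4, …, α ^ H` (no edges are
generated at level `1`). -/
def outputEdges {d : ℕ} {X : Finset (EuclideanSpace ℝ (Fin d))} (p : Params)
    (sp : ℕ → Set X → SimpleGraph X) (ch : Choices X) (a : Fin d → ℝ) (ω : Coins X p) :
    Set (Sym2 X) :=
  ⋃ j ∈ Finset.Icc 1 p.top, levelEdges p sp ch a ω j

open Classical in
/-- The expected weight of the output, over the random shift and the independent fair coins. The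
spanners and the arbitrary choices may depend on the shift. -/
def expectedWeight {d : ℕ} {X : Finset (EuclideanSpace ℝ (Fin d))} (p : Params) (Δ : ℝ)
    (sp : (Fin d → ℝ) → ℕ → Set X → SimpleGraph X) (ch : (Fin d → ℝ) → Choices X) : ENNReal :=
  ∫⁻ a, ENNReal.ofReal
    ((∑ ω : Coins X p, weight (outputEdges p (sp a) (ch a) a ω)) / Fintype.card (Coins X p))
    ∂(shiftLaw d Δ)

end EuclidMST

end

/-! Tree property. The partitions `hatPartition` increase with the level and contain all spanner
edges of their level (`hatPartition_mono`, `hatPartition_of_adj`). At level 1 the partition is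
discrete, because distinct points are far apart; at the top it is trivial, because all points share
one cell and are within the spanner length. A round loses at least one leader per produced edge, and
a star on `m` leaders has `m - 1` edges, so a level has at most as many edges as the number of
classes drops (`ncard_levelEdges_add_le`). Telescoping gives at most `n - 1` edges in all. The edges
up to a level connect each class of its partition (`hatPartition_rel_of_outputEdges`), so the output
is connected with at most `n - 1` edges: a tree.

Weight. At level `2 ^ j` the round edges have length at most `Cs * 2 ^ j`, and there are fewer of
them than components of the spanner graph at level `2 ^ (j - 1)`. Star edges may be as long as the
diameter of a cell of side `α ^ (k + 1) / β`, but they are rare: the leaves of the stars are charged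
to parts left incomplete by one of the two compression phases (`ncard_starLeaves_le_of_merge`). An
incomplete part merges away with probability at least 1/4 in each round, so on average a factor `(3
/ 4) ^ h` of the initial number remains (`sum_incompleteLeaders_le_card`), and that number is
controlled by the nonempty cells of side `α ^ (k - 1) / β`.

Both counts are compared with a minimum spanning tree `T`: a partition with `m` classes is crossed
by at least `m - 1` edges of `T` (`card_quotient_le_ncard_crossing`). An edge of `T` joining
different spanner components is longer than `2 ^ (j - 1)` or cut by the grid; an edge of length `ℓ`
is cut by the grid of side `L` with probability at most `2 * d * ℓ / L` (`shiftLaw_cellIdx_ne_le`).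
Summed over the levels, the long edges give a geometric series of total `4 * Cs * ℓ`. The cut edges
give polylogarithmic factors, absorbed by `β / α` for the rounds and by `(3 / 4) ^ h` for the stars,
so the constant depends on `Cs` only. -/

noncomputable section

namespace EuclidMST

/-! ### Leader compression: deterministic invariants -/

section Compression

variable {V : Type*}

/-- `sel` selects an admissible message for every leader that has one. -/
def IsSelection (G : SimpleGraph V) (l : V → V) (coin : V → Bool) (sel : V → V × V) : Prop :=
  ∀ z, (messages G l coin z).Nonempty → sel z ∈ messages G l coin z

variable {G : SimpleGraph V} {l : V → V} {coin : V → Bool} {sel : V → V × V}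

theorem compress_of_nonempty {y : V} (h : (messages G l coin (l y)).Nonempty) :
    compress G sel l coin y = l (sel (l y)).1 := if_pos h

theorem compress_of_not_nonempty {y : V} (h : ¬ (messages G l coin (l y)).Nonempty) :
    compress G sel l coin y = l y := if_neg h

theorem not_messages_of_coin {z : V} (h : coin z = true) : ¬ (messages G l coin z).Nonempty := by
  rintro ⟨m, -, -, -, h'⟩
  simp [h] at h'

theorem compress_eq_of_eq {x y : V} (h : l x = l y) :
    compress G sel l coin x = compress G sel l coin y := by
  unfold compress
  rw [h]

theorem compress_mem_range (y : V) : compress G sel l coin y ∈ Set.range l := by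
  unfold compress
  split_ifs <;> exact ⟨_, rfl⟩

/-- Only coin-0 leaders merge, and only into coin-1 leaders, which stay put in the same round. Hence
merges never chain. -/
theorem compress_idem (hl : ∀ x, l (l x) = l x) (hs : IsSelection G l coin sel) (x : V) :
    compress G sel l coin (compress G sel l coin x) = compress G sel l coin x := by
  by_cases h : (messages G l coin (l x)).Nonempty
  · obtain ⟨-, -, h1, -⟩ := hs _ h
    rw [compress_of_nonempty h, compress_of_not_nonempty, hl]
    rw [hl]
    exact not_messages_of_coin h1
  · rw [compress_of_not_nonempty h, compress_of_not_nonempty, hl]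
    rwa [hl]

theorem compress_ne_of_messages (hl : ∀ x, l (l x) = l x) (hs : IsSelection G l coin sel) {z : V}
    (hz : (messages G l coin z).Nonempty) (x : V) : compress G sel l coin x ≠ z := by
  intro h
  have hi := compress_idem hl hs x
  have hlz : l z = z := by
    obtain ⟨m, -, h2, -⟩ := hz
    rw [← h2, hl]
  rw [h] at hi
  have hz' : (messages G l coin (l z)).Nonempty := by rwa [hlz]
  rw [compress_of_nonempty hz'] at hi
  obtain ⟨-, -, h1, h0⟩ := hs _ hz'
  rw [hi] at h1
  rw [hlz, h1] at h0
  simp at h0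

theorem compress_rel (hs : IsSelection G l coin sel) {S : Setoid V} (hG : ∀ x y, G.Adj x y → S x y)
    (hl : ∀ x, S x (l x)) (x : V) : S x (compress G sel l coin x) := by
  by_cases h : (messages G l coin (l x)).Nonempty
  · obtain ⟨h1, h2, -, -⟩ := hs _ h
    rw [compress_of_nonempty h]
    have e1 : S (sel (l x)).2 (l x) := by
      have := hl (sel (l x)).2
      rwa [h2] at this
    exact S.trans' (hl x) (S.trans' (S.symm' e1) (S.trans' (S.symm' (hG _ _ h1)) (hl _)))
  · rw [compress_of_not_nonempty h]
    exact hl x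

/-- Each leader with a message accounts for at most one edge and ceases to be a leader. Losing
leaders and surviving leaders are disjoint sets of old leaders. -/
theorem ncard_compressEdges_add_le [Finite V] (hl : ∀ x, l (l x) = l x)
    (hs : IsSelection G l coin sel) :
    (compressEdges G sel l coin).ncard + (Set.range (compress G sel l coin)).ncard ≤
      (Set.range l).ncard := by
  have himg : compressEdges G sel l coin =
      (fun z => s((sel z).1, (sel z).2)) '' {z | (messages G l coin z).Nonempty} := by
    ext e
    simp only [compressEdges, Set.mem_ofPred_eq, Set.mem_image]
    exact exists_congr fun z => and_congr_right fun _ => eq_comm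
  have h1 : (compressEdges G sel l coin).ncard ≤ {z | (messages G l coin z).Nonempty}.ncard := by
    rw [himg]
    exact Set.ncard_image_le (Set.toFinite _)
  have hd : Disjoint {z | (messages G l coin z).Nonempty}
      (Set.range (compress G sel l coin)) := by
    rw [Set.disjoint_left]
    rintro z hz ⟨x, hx⟩
    exact compress_ne_of_messages hl hs hz x hx
  have h2 : {z | (messages G l coin z).Nonempty} ∪ Set.range (compress G sel l coin) ⊆
      Set.range l := by
    rintro z (⟨m, -, h, -⟩ | ⟨x, rfl⟩)
    · exact ⟨_, h⟩
    · exact compress_mem_range x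
  have h3 := Set.ncard_le_ncard h2 (Set.toFinite _)
  rw [Set.ncard_union_eq hd (Set.toFinite _) (Set.toFinite _)] at h3
  omega

theorem not_messages_of_complete {z : V}
    (hz : ¬ Incomplete G l z) : ¬ (messages G l coin z).Nonempty := by
  rintro ⟨m, h1, h2, h3, h4⟩
  refine hz ⟨m.2, m.1, h1.symm, ?_, h2⟩
  intro h
  rw [h2] at h
  rw [← h, h4] at h3
  simp at h3

/-- A leader that is incomplete after a round was incomplete before it, and has not merged. -/
theorem Incomplete.of_compress (hl : ∀ x, l (l x) = l x) (hs : IsSelection G l coin sel) {z : V}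
    (hz : Incomplete G (compress G sel l coin) z) :
    Incomplete G l z ∧ ¬ (messages G l coin z).Nonempty := by
  obtain ⟨x, y, hxy, hne, hx⟩ := hz
  refine ⟨?_, fun h => compress_ne_of_messages hl hs h x hx⟩
  by_contra hc
  -- A part can only join `z` along an edge leaving the part of `z`, so a complete part is unchanged
  -- by the round.
  have key : ∀ w, compress G sel l coin w = z ↔ l w = z := by
    intro w
    by_cases h : (messages G l coin (l w)).Nonempty
    · obtain ⟨h1, h2, h3, h4⟩ := hs _ h
      constructor
      · intro hw
        rw [compress_of_nonempty h] at hw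
        refine absurd ⟨_, _, h1, ?_, hw⟩ hc
        intro h5
        rw [h5, h2, h4] at h3
        simp at h3
      · intro hw
        rw [hw] at h
        exact absurd h (not_messages_of_complete hc)
    · rw [compress_of_not_nonempty h]
  refine hc ⟨x, y, hxy, ?_, (key x).mp hx⟩
  intro h
  apply hne
  rw [hx, eq_comm, key, ← h, ← key, hx]

theorem ncard_range_eq_card_quotient {P : Setoid V} (h : ∀ x y, P x y ↔ l x = l y) :
    (Set.range l).ncard = Nat.card (Quotient P) := by
  have hP : P = Setoid.ker l := by
    ext x y
    exact h x y
  rw [hP, ← Nat.card_coe_set_eq]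
  exact Nat.card_congr (Setoid.quotientKerEquivRange l).symm

end Compression

/-! ### Iterated rounds from an initial partition -/

section Leaders

variable {V : Type*} (ch : Choices V) (s : Phase) (j : ℕ) (G : SimpleGraph V)
  (coins : ℕ → V → Bool) (P : Setoid V)

theorem isSelection_message (i : ℕ) (l : V → V) (coin : V → Bool) :
    IsSelection G l coin (ch.message s j i G l coin) :=
  fun z hz => ch.message_mem s j i G l coin z hz

theorem leaders_idem (i : ℕ) (x : V) :
    leaders ch s j G coins P i (leaders ch s j G coins P i x) = leaders ch s j G coins P i x := by
  induction i generalizing x with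
  | zero => exact (ch.leader_eq s j P _ _ (ch.leader_rel s j P x)).symm
  | succ i ih => exact compress_idem ih (isSelection_message ch s j G i _ _) x

theorem leaders_eq_of_rel {x y : V} (h : P x y) (i : ℕ) :
    leaders ch s j G coins P i x = leaders ch s j G coins P i y := by
  induction i with
  | zero => exact ch.leader_eq s j P _ _ h
  | succ i ih => exact compress_eq_of_eq ih

theorem leaders_zero_eq_iff (x y : V) :
    P x y ↔ leaders ch s j G coins P 0 x = leaders ch s j G coins P 0 y := by
  refine ⟨fun h => ch.leader_eq s j P _ _ h, fun h => ?_⟩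
  refine P.trans' (ch.leader_rel s j P x) (P.symm' ?_)
  have := ch.leader_rel s j P y
  rwa [show ch.leader s j P x = ch.leader s j P y from h]

variable {P G} in
theorem leaders_rel {S : Setoid V} (hP : P ≤ S) (hG : ∀ x y, G.Adj x y → S x y) (i : ℕ) (x : V) :
    S x (leaders ch s j G coins P i x) := by
  induction i generalizing x with
  | zero => exact hP (ch.leader_rel s j P x)
  | succ i ih => exact compress_rel (isSelection_message ch s j G i _ _) hG ih x

theorem leaders_congr {coins coins' : ℕ → V → Bool} (i : ℕ)
    (h : ∀ i' < i, coins i' = coins' i') :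
    leaders ch s j G coins P i = leaders ch s j G coins' P i := by
  induction i with
  | zero => rfl
  | succ i ih =>
    simp only [leaders]
    rw [ih fun i' hi' => h i' (hi'.trans i.lt_succ_self), h i i.lt_succ_self]

theorem ncard_range_leaders_zero :
    (Set.range (leaders ch s j G coins P 0)).ncard = Nat.card (Quotient P) :=
  ncard_range_eq_card_quotient (leaders_zero_eq_iff ch s j G coins P)

/-- The edges produced in round `i`. -/
def roundEdges (i : ℕ) : Set (Sym2 V) :=
  compressEdges G (ch.message s j i G (leaders ch s j G coins P i) (coins i))
    (leaders ch s j G coins P i) (coins i)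

theorem sum_ncard_roundEdges_add_le [Finite V] (h : ℕ) :
    ∑ i ∈ Finset.range h, (roundEdges ch s j G coins P i).ncard +
      (Set.range (leaders ch s j G coins P h)).ncard ≤ Nat.card (Quotient P) := by
  induction h with
  | zero => simp [ncard_range_leaders_zero]
  | succ h ih =>
    rw [Finset.sum_range_succ]
    have : (roundEdges ch s j G coins P h).ncard +
        (Set.range (leaders ch s j G coins P (h + 1))).ncard ≤
        (Set.range (leaders ch s j G coins P h)).ncard :=
      ncard_compressEdges_add_le (leaders_idem ch s j G coins P h)
        (isSelection_message ch s j G h _ _)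
    omega

theorem adj_of_mem_roundEdges {i : ℕ} {e : Sym2 V} (he : e ∈ roundEdges ch s j G coins P i) :
    e ∈ G.edgeSet := by
  obtain ⟨z, hz, rfl⟩ := he
  exact (isSelection_message ch s j G i _ _ z hz).1

/-- If the edges of all rounds lie in an equivalence relation containing the initial partition,
so does the leader map. -/
theorem leaders_rel_of_roundEdges {S : Setoid V} (hP : P ≤ S) (h : ℕ)
    (hS : ∀ i < h, ∀ x y, s(x, y) ∈ roundEdges ch s j G coins P i → S x y) (x : V) :
    S x (leaders ch s j G coins P h x) := by
  induction h generalizing x with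
  | zero => exact hP (ch.leader_rel s j P x)
  | succ h ih =>
    have ih' := ih fun i hi => hS i (hi.trans h.lt_succ_self)
    simp only [leaders]
    set l := leaders ch s j G coins P h with hl
    by_cases hm : (messages G l (coins h) (l x)).Nonempty
    · rw [compress_of_nonempty hm]
      obtain ⟨h1, h2, -, -⟩ := isSelection_message ch s j G h _ _ _ hm
      set m := ch.message s j h G l (coins h) (l x)
      have e1 : S m.2 (l x) := by
        have := ih' m.2
        rwa [h2] at this
      have e2 : S m.1 m.2 := hS h h.lt_succ_self _ _ ⟨l x, hm, rfl⟩
      exact S.trans' (ih' x) (S.trans' (S.symm' e1) (S.trans' (S.symm' e2) (ih' _)))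
    · rw [compress_of_not_nonempty hm]
      exact ih' x

/-! ### Merging incomplete components -/

variable {P G} in
theorem le_mergeIncomplete_leaders (R : Setoid V) (h : ℕ) :
    P ≤ mergeIncomplete G (leaders ch s j G coins P h) R :=
  fun _ _ hxy => Or.inl (leaders_eq_of_rel ch s j G coins P hxy h)

variable {P G} in
theorem mergeIncomplete_leaders_le {R : Setoid V} (hP : P ≤ R) (hG : ∀ x y, G.Adj x y → R x y)
    (h : ℕ) : mergeIncomplete G (leaders ch s j G coins P h) R ≤ R := by
  have hl := leaders_rel ch s j coins hP hG h
  rintro x y (hxy | ⟨-, -, hxy⟩)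
  · refine R.trans' (hl x) ?_
    rw [hxy]
    exact R.symm' (hl y)
  · exact R.trans' (hl x) (R.trans' hxy (R.symm' (hl y)))

-- An edge between two different parts makes both incomplete, and their leaders are related by `R`
-- since parts and edges stay inside `R`; so the merge joins them.
variable {P G} in
theorem mergeIncomplete_leaders_of_adj {R : Setoid V} (hP : P ≤ R)
    (hG : ∀ x y, G.Adj x y → R x y) (h : ℕ) {x y : V} (hxy : G.Adj x y) :
    mergeIncomplete G (leaders ch s j G coins P h) R x y := by
  have hl := leaders_rel ch s j coins hP hG h
  by_cases he : leaders ch s j G coins P h x = leaders ch s j G coins P h y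
  · exact Or.inl he
  · exact Or.inr ⟨⟨x, y, hxy, he, rfl⟩, ⟨y, x, hxy.symm, Ne.symm he, rfl⟩,
      R.trans' (R.symm' (hl x)) (R.trans' (hG _ _ hxy) (hl y))⟩

/-- The number of incomplete components is initially at most twice the number of components,
minus two. -/
theorem ncard_incomplete_le [Finite V] :
    {z | Incomplete G (leaders ch s j G coins P 0) z}.ncard ≤ 2 * (Nat.card (Quotient P) - 1) := by
  rw [← ncard_range_leaders_zero ch s j G coins P]
  set l := leaders ch s j G coins P 0
  have hsub : {z | Incomplete G l z} ⊆ Set.range l := by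
    rintro z ⟨x, -, -, -, rfl⟩
    exact ⟨x, rfl⟩
  have h1 := Set.ncard_le_ncard hsub (Set.toFinite _)
  rcases Set.eq_empty_or_nonempty {z | Incomplete G l z} with h | ⟨z, x, y, -, hne, -⟩
  · simp [h]
  -- One incomplete part forces `m ≥ 2` parts, hence `m ≤ 2 * (m - 1)`. The form with `m - 1` is
  -- what can be charged to tree edges.
  · have : 1 < (Set.range l).ncard :=
      (Set.one_lt_ncard (Set.toFinite _)).mpr ⟨l x, ⟨x, rfl⟩, l y, ⟨y, rfl⟩, hne⟩
    omega

end Leaders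

/-! ### Trees and partitions -/

/-- The number of edges of a tree between different classes is at least the number of classes
minus one. -/
theorem card_quotient_le_ncard_crossing {V : Type*} [Finite V] {T : SimpleGraph V}
    (hT : T.Connected) (S : Setoid V) :
    Nat.card (Quotient S) ≤
      {e | e ∈ T.edgeSet ∧ ¬ e.map (Quotient.mk S) ∈ Sym2.diagSet}.ncard + 1 := by
  set Q : SimpleGraph (Quotient S) := SimpleGraph.fromEdgeSet
    (Sym2.map (Quotient.mk S) '' T.edgeSet) with hQ
  have hreach : ∀ x y, T.Reachable x y → Q.Reachable (Quotient.mk S x) (Quotient.mk S y) := by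
    rintro x y ⟨w⟩
    induction w with
    | nil => rfl
    | cons h _ ih =>
      refine SimpleGraph.Reachable.trans ?_ ih
      rename_i u v _ _
      by_cases he : Quotient.mk S u = Quotient.mk S v
      · rw [he]
      · refine SimpleGraph.Adj.reachable ?_
        rw [hQ, SimpleGraph.fromEdgeSet_adj]
        exact ⟨⟨s(u, v), h, by simp⟩, he⟩
  have hc : Q.Connected := by
    have := hT.nonempty
    have : Nonempty (Quotient S) := ⟨Quotient.mk S hT.nonempty.some⟩
    refine ⟨fun u v => ?_⟩
    induction u using Quotient.inductionOn
    induction v using Quotient.inductionOn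
    exact hreach _ _ (hT.preconnected _ _)
  have h1 := hc.card_vert_le_card_edgeSet_add_one
  refine h1.trans (Nat.add_le_add_right ?_ 1)
  -- The quotient graph of a connected graph is connected, so it has at least `m - 1` edges; each is
  -- the image of a crossing edge.
  have hsub : Q.edgeSet ⊆ Sym2.map (Quotient.mk S) ''
      {e | e ∈ T.edgeSet ∧ ¬ e.map (Quotient.mk S) ∈ Sym2.diagSet} := by
    rw [hQ, SimpleGraph.edgeSet_fromEdgeSet]
    rintro _ ⟨⟨e, he, rfl⟩, hd⟩
    exact ⟨e, ⟨he, hd⟩, rfl⟩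
  exact (Set.ncard_le_ncard hsub (Set.toFinite _)).trans (Set.ncard_image_le (Set.toFinite _))

theorem card_quotient_le_of_le {V : Type*} [Finite V] {P Q : Setoid V} (h : P ≤ Q) :
    Nat.card (Quotient Q) ≤ Nat.card (Quotient P) :=
  Nat.card_le_card_of_surjective (Quotient.map' id h) fun q => by
    induction q using Quotient.inductionOn with
    | h x => exact ⟨Quotient.mk P x, rfl⟩

/-! ### Cells -/

section Cells

variable {d : ℕ}

/-- The same shift `a` is used at every scale, so grids whose sides have an integer ratio are
nested. -/
theorem cellIdx_mul_natCast (a : Fin d → ℝ) (L : ℝ) (m : ℕ) (x : EuclideanSpace ℝ (Fin d)) :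
    cellIdx a (L * m) x = fun i => cellIdx a L x i / (m : ℤ) := by
  funext i
  rw [cellIdx, cellIdx, ← div_div, Int.floor_div_natCast]

theorem cellPartition_le_mul_natCast (X : Finset (EuclideanSpace ℝ (Fin d))) (a : Fin d → ℝ)
    (L : ℝ) (m : ℕ) : cellPartition X a L ≤ cellPartition X a (L * m) := by
  intro x y h
  change cellIdx a (L * m) x = cellIdx a (L * m) y
  rw [cellIdx_mul_natCast, cellIdx_mul_natCast, show cellIdx a L x = cellIdx a L y from h]

theorem abs_sub_le_of_cellIdx_eq {a : Fin d → ℝ} {L : ℝ} (hL : 0 < L)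
    {x y : EuclideanSpace ℝ (Fin d)} (h : cellIdx a L x = cellIdx a L y) (i : Fin d) :
    |x i - y i| ≤ L := by
  have h1 : ⌊(x i + a i) / L⌋ = ⌊(y i + a i) / L⌋ := congrFun h i
  have h2 := Int.abs_sub_lt_one_of_floor_eq_floor h1
  rw [← sub_div, abs_div, abs_of_pos hL, div_lt_one hL] at h2
  rw [show x i - y i = x i + a i - (y i + a i) by ring]
  exact h2.le

theorem dist_le_sum_abs (x y : EuclideanSpace ℝ (Fin d)) : dist x y ≤ ∑ i, |x i - y i| := by
  rw [EuclideanSpace.dist_eq]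
  refine Real.sqrt_le_iff.mpr ⟨Finset.sum_nonneg fun _ _ => abs_nonneg _, ?_⟩
  simp only [Real.dist_eq]
  exact Finset.sum_sq_le_sq_sum_of_nonneg fun _ _ => abs_nonneg _

theorem dist_le_of_cellIdx_eq {a : Fin d → ℝ} {L : ℝ} (hL : 0 < L)
    {x y : EuclideanSpace ℝ (Fin d)} (h : cellIdx a L x = cellIdx a L y) : dist x y ≤ d * L := by
  refine (dist_le_sum_abs x y).trans ?_
  refine (Finset.sum_le_sum fun i _ => abs_sub_le_of_cellIdx_eq hL h i).trans ?_
  simp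

theorem abs_coord_sub_le_dist (x y : EuclideanSpace ℝ (Fin d)) (i : Fin d) :
    |x i - y i| ≤ dist x y := by
  have := PiLp.norm_apply_le (x - y) i
  rwa [← dist_eq_norm] at this

end Cells

/-! ### Arithmetic of cell sides and level indices -/

namespace Params

variable (p : Params)

theorem α_pos : 0 < p.α := by unfold α; positivity

theorem β_pos : 0 < p.β := by unfold β; positivity

theorem one_lt_α : 1 < p.α := by
  unfold α
  exact one_lt_pow₀ (by norm_num) (by positivity)

/-- The side `α ^ k / β` of the cells. -/
def side (k : ℕ) : ℝ := p.α ^ k / p.β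

theorem side_pos (k : ℕ) : 0 < p.side k := div_pos (pow_pos p.α_pos k) p.β_pos

theorem side_add (k r : ℕ) : p.side (k + r) = p.side k * ((2 ^ (2 ^ p.g * r) : ℕ) : ℝ) := by
  simp only [side, α, pow_add, pow_mul]
  push_cast
  ring

theorem idx_mul (k : ℕ) : p.idx (k * 2 ^ p.g) = k := by
  unfold idx
  have h : 0 < 2 ^ p.g := by positivity
  rw [Nat.add_sub_assoc h, add_comm, Nat.add_mul_div_right _ _ h, Nat.div_eq_of_lt (by omega),
    zero_add]

theorem idx_mono {i j : ℕ} (h : i ≤ j) : p.idx i ≤ p.idx j :=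
  Nat.div_le_div_right (by omega)

theorem le_idx_mul (j : ℕ) : j ≤ p.idx j * 2 ^ p.g := by
  unfold idx
  have h : 0 < 2 ^ p.g := by positivity
  have h1 := Nat.div_add_mod (j + 2 ^ p.g - 1) (2 ^ p.g)
  have h2 := Nat.mod_lt (j + 2 ^ p.g - 1) h
  rw [mul_comm] at h1
  omega

theorem idx_pred_mul_lt {j : ℕ} (hj : 1 ≤ j) : 1 ≤ p.idx j ∧ (p.idx j - 1) * 2 ^ p.g < j := by
  have h : 0 < 2 ^ p.g := by positivity
  have h0 : 1 ≤ p.idx j := by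
    have := p.le_idx_mul j
    by_contra hc
    rw [show p.idx j = 0 by omega] at this
    omega
  refine ⟨h0, ?_⟩
  have h1 : p.idx j * 2 ^ p.g ≤ j + 2 ^ p.g - 1 := Nat.div_mul_le_self _ _
  rw [Nat.sub_mul, one_mul]
  omega

theorem two_pow_le_α_pow_idx (j : ℕ) : (2 : ℝ) ^ j ≤ p.α ^ p.idx j := by
  rw [α, ← pow_mul, mul_comm]
  exact pow_le_pow_right₀ (by norm_num) (p.le_idx_mul j)

end Params

/-! ### The partitions form an increasing hierarchy -/

section Hat

variable {d : ℕ} {X : Finset (EuclideanSpace ℝ (Fin d))}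

theorem cellPartition_side_mono (p : Params) (X : Finset (EuclideanSpace ℝ (Fin d)))
    (a : Fin d → ℝ) {k k' : ℕ} (h : k ≤ k') :
    cellPartition X a (p.side k) ≤ cellPartition X a (p.side k') := by
  obtain ⟨r, rfl⟩ := Nat.exists_eq_add_of_le h
  rw [p.side_add]
  exact cellPartition_le_mul_natCast ..

theorem spannerGraph_adj {p : Params} {sp : ℕ → Set X → SimpleGraph X} {a : Fin d → ℝ} {j : ℕ}
    {x y : X} : (spannerGraph p sp a j).Adj x y ↔
      ∃ i ≤ j, ∃ c, (sp i (cellPoints X a (p.side (p.idx i + 1)) c)).Adj x y := by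
  simp only [spannerGraph, SimpleGraph.iSup_adj, Params.side, exists_prop]

theorem spannerGraph_mono (p : Params) (sp : ℕ → Set X → SimpleGraph X) (a : Fin d → ℝ)
    {i j : ℕ} (h : i ≤ j) {x y : X} (hxy : (spannerGraph p sp a i).Adj x y) :
    (spannerGraph p sp a j).Adj x y := by
  rw [spannerGraph_adj] at hxy ⊢
  obtain ⟨i', hi', c, hc⟩ := hxy
  exact ⟨i', hi'.trans h, c, hc⟩

variable {Cs : ℝ} {p : Params} {sp : ℕ → Set X → SimpleGraph X}

theorem cellPartition_of_spannerGraph_adj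
    (hsp : ∀ j Y, IsTwoHopSpanner Cs (2 ^ j) Y (sp j Y)) {a : Fin d → ℝ} {j : ℕ} {x y : X}
    (h : (spannerGraph p sp a j).Adj x y) : cellPartition X a (p.side (p.idx j + 1)) x y := by
  obtain ⟨i, hi, c, hc⟩ := spannerGraph_adj.mp h
  obtain ⟨hx, hy⟩ := (hsp _ _).mem _ _ hc
  refine cellPartition_side_mono p X a (Nat.add_le_add_right (p.idx_mono hi) 1) ?_
  exact Eq.trans hx (Eq.symm hy)

theorem dist_le_of_spannerGraph_adj (hCs : 0 ≤ Cs)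
    (hsp : ∀ j Y, IsTwoHopSpanner Cs (2 ^ j) Y (sp j Y)) {a : Fin d → ℝ} {j : ℕ} {x y : X}
    (h : (spannerGraph p sp a j).Adj x y) :
    dist (x : EuclideanSpace ℝ (Fin d)) y ≤ Cs * 2 ^ j := by
  obtain ⟨i, hi, c, hc⟩ := spannerGraph_adj.mp h
  refine ((hsp _ _).short _ _ hc).trans (mul_le_mul_of_nonneg_left ?_ hCs)
  exact pow_le_pow_right₀ (by norm_num) hi

/-- Two hops suffice. The arbitrary relation `S` allows use both for the components of the spanner
graph and for `hatPartition`. -/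
theorem spannerGraph_rel_of_close
    (hsp : ∀ j Y, IsTwoHopSpanner Cs (2 ^ j) Y (sp j Y)) {a : Fin d → ℝ} {j : ℕ} {x y : X}
    (hcell : cellPartition X a (p.side (p.idx j + 1)) x y)
    (hd : dist (x : EuclideanSpace ℝ (Fin d)) y ≤ 2 ^ j) {S : Setoid X}
    (hS : ∀ u v, (spannerGraph p sp a j).Adj u v → S u v) : S x y := by
  by_cases hxy : x = y
  · exact hxy ▸ S.refl' x
  have hadj : ∀ u v, (sp j (cellPoints X a (p.side (p.idx j + 1))
      (cellIdx a (p.side (p.idx j + 1)) x))).Adj u v → S u v :=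
    fun u v h => hS u v (spannerGraph_adj.mpr ⟨j, le_rfl, _, h⟩)
  rcases (hsp j (cellPoints X a (p.side (p.idx j + 1)) (cellIdx a (p.side (p.idx j + 1)) x))).hop
    x rfl y (Eq.symm hcell) hxy hd with h | ⟨r, -, h1, h2⟩
  · exact hadj _ _ h
  · exact S.trans' (hadj _ _ h1) (hadj _ _ h2)

variable (ch : Choices X) (a : Fin d → ℝ) (ω : Coins X p)

theorem hatPartition_mul (sp : ℕ → Set X → SimpleGraph X) (k : ℕ) :
    hatPartition p sp ch a ω (k * 2 ^ p.g) =
      mergeIncomplete (spannerGraph p sp a (k * 2 ^ p.g))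
        (leaders ch .components (k * 2 ^ p.g) (spannerGraph p sp a (k * 2 ^ p.g))
          (coinsAt ω .components (k * 2 ^ p.g)) (cellPartition X a (p.side k)) p.h)
        (cellPartition X a (p.side (k + 1))) := by
  rw [hatPartition, dif_pos (Dvd.intro_left k rfl), Nat.mul_div_cancel _ (by positivity)]
  rfl

theorem hatPartition_of_not_dvd (sp : ℕ → Set X → SimpleGraph X) {j : ℕ} (hj : ¬ 2 ^ p.g ∣ j) :
    hatPartition p sp ch a ω j =
      mergeIncomplete (spannerGraph p sp a j)
        (leaders ch .components j (spannerGraph p sp a j) (coinsAt ω .components j)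
          (hatPartition p sp ch a ω (j - 2 ^ padicValNat 2 j)) p.h)
        (hatPartition p sp ch a ω (j + 2 ^ padicValNat 2 j)) := by
  rw [hatPartition, dif_neg hj]

theorem padicValNat_odd_mul_two_pow (q v : ℕ) : padicValNat 2 ((2 * q + 1) * 2 ^ v) = v := by
  rw [padicValNat.mul (by omega) (by positivity), padicValNat.prime_pow,
    padicValNat.eq_zero_of_not_dvd (by omega), zero_add]

variable (hsp : ∀ j Y, IsTwoHopSpanner Cs (2 ^ j) Y (sp j Y))
include hsp

theorem hatPartition_mul_spec (k : ℕ) :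
    cellPartition X a (p.side k) ≤ hatPartition p sp ch a ω (k * 2 ^ p.g) ∧
    hatPartition p sp ch a ω (k * 2 ^ p.g) ≤ cellPartition X a (p.side (k + 1)) ∧
    ∀ x y, (spannerGraph p sp a (k * 2 ^ p.g)).Adj x y →
      hatPartition p sp ch a ω (k * 2 ^ p.g) x y := by
  have hP := cellPartition_side_mono p X a k.le_succ
  have hG : ∀ x y, (spannerGraph p sp a (k * 2 ^ p.g)).Adj x y →
      cellPartition X a (p.side (k + 1)) x y := by
    intro x y h
    have := cellPartition_of_spannerGraph_adj hsp h
    rwa [p.idx_mul] at this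
  rw [hatPartition_mul]
  exact ⟨le_mergeIncomplete_leaders .., mergeIncomplete_leaders_le _ _ _ _ hP hG _,
    fun x y h => mergeIncomplete_leaders_of_adj _ _ _ _ hP hG _ h⟩

/-- Induction over dyadic refinement of the exponents, matching the recursion of `hatPartition`. A
new midpoint starts from its left neighbour and merges inside its right neighbour. By induction the
left one refines the right one, and the right one contains the spanner edges of the midpoint, so the
midpoint lies between them. -/
theorem hatPartition_dyadic_spec (u : ℕ) (hu : u ≤ p.g) (m : ℕ) :
    hatPartition p sp ch a ω (m * 2 ^ (p.g - u)) ≤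
      hatPartition p sp ch a ω ((m + 1) * 2 ^ (p.g - u)) ∧
    ∀ x y, (spannerGraph p sp a (m * 2 ^ (p.g - u))).Adj x y →
      hatPartition p sp ch a ω (m * 2 ^ (p.g - u)) x y := by
  induction u generalizing m with
  | zero =>
    rw [Nat.sub_zero]
    exact ⟨(hatPartition_mul_spec ch a ω hsp m).2.1.trans
      (hatPartition_mul_spec ch a ω hsp (m + 1)).1, (hatPartition_mul_spec ch a ω hsp m).2.2⟩
  | succ u ih =>
    have ih := ih (by omega)
    set v := p.g - (u + 1) with hv
    have hv' : p.g - u = v + 1 := by omega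
    rw [hv'] at ih
    have hodd : ∀ q,
        hatPartition p sp ch a ω (2 * q * 2 ^ v) ≤
          hatPartition p sp ch a ω ((2 * q + 1) * 2 ^ v) ∧
        hatPartition p sp ch a ω ((2 * q + 1) * 2 ^ v) ≤
          hatPartition p sp ch a ω ((2 * q + 2) * 2 ^ v) ∧
        ∀ x y, (spannerGraph p sp a ((2 * q + 1) * 2 ^ v)).Adj x y →
          hatPartition p sp ch a ω ((2 * q + 1) * 2 ^ v) x y := by
      intro q
      have hval := padicValNat_odd_mul_two_pow q v
      have hnd : ¬ 2 ^ p.g ∣ (2 * q + 1) * 2 ^ v := by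
        rw [padicValNat_dvd_iff_le (by positivity), hval]
        omega
      have e1 : (2 * q + 1) * 2 ^ v - 2 ^ v = 2 * q * 2 ^ v := by
        rw [Nat.add_mul, one_mul, Nat.add_sub_cancel]
      have e2 : (2 * q + 1) * 2 ^ v + 2 ^ v = (2 * q + 2) * 2 ^ v := by ring
      have hP : hatPartition p sp ch a ω (2 * q * 2 ^ v) ≤
          hatPartition p sp ch a ω ((2 * q + 2) * 2 ^ v) := by
        have := (ih q).1
        rwa [show q * 2 ^ (v + 1) = 2 * q * 2 ^ v by ring,
          show (q + 1) * 2 ^ (v + 1) = (2 * q + 2) * 2 ^ v by ring] at this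
      have hG : ∀ x y, (spannerGraph p sp a ((2 * q + 1) * 2 ^ v)).Adj x y →
          hatPartition p sp ch a ω ((2 * q + 2) * 2 ^ v) x y := by
        intro x y h
        have := (ih (q + 1)).2 x y
        rw [show (q + 1) * 2 ^ (v + 1) = (2 * q + 2) * 2 ^ v by ring] at this
        exact this (spannerGraph_mono p sp a (Nat.mul_le_mul_right _ (by omega)) h)
      rw [hatPartition_of_not_dvd ch a ω sp hnd, hval, e1, e2]
      exact ⟨le_mergeIncomplete_leaders .., mergeIncomplete_leaders_le _ _ _ _ hP hG _,
        fun x y h => mergeIncomplete_leaders_of_adj _ _ _ _ hP hG _ h⟩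
    rcases Nat.even_or_odd' m with ⟨q, rfl | rfl⟩
    · refine ⟨(hodd q).1, ?_⟩
      have := (ih q).2
      rwa [show q * 2 ^ (v + 1) = 2 * q * 2 ^ v by ring] at this
    · exact ⟨(hodd q).2.1, (hodd q).2.2⟩

theorem hatPartition_of_adj {j : ℕ} {x y : X} (h : (spannerGraph p sp a j).Adj x y) :
    hatPartition p sp ch a ω j x y := by
  have := (hatPartition_dyadic_spec ch a ω hsp p.g le_rfl j).2 x y
  rw [show j * 2 ^ (p.g - p.g) = j by simp] at this
  exact this h

theorem hatPartition_mono {i j : ℕ} (h : i ≤ j) :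
    hatPartition p sp ch a ω i ≤ hatPartition p sp ch a ω j := by
  refine monotone_nat_of_le_succ (f := hatPartition p sp ch a ω) (fun m => ?_) h
  have := (hatPartition_dyadic_spec ch a ω hsp p.g le_rfl m).1
  simpa using this

theorem hatPartition_le_cellPartition (j : ℕ) :
    hatPartition p sp ch a ω j ≤ cellPartition X a (p.side (p.idx j + 1)) :=
  (hatPartition_mono ch a ω hsp (p.le_idx_mul j)).trans
    (hatPartition_mul_spec ch a ω hsp (p.idx j)).2.1

theorem cellPartition_le_hatPartition {k j : ℕ} (h : k * 2 ^ p.g ≤ j) :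
    cellPartition X a (p.side k) ≤ hatPartition p sp ch a ω j :=
  (hatPartition_mul_spec ch a ω hsp k).1.trans (hatPartition_mono ch a ω hsp h)

end Hat

/-! ### Stars on the remaining leaders -/

section Stars

variable {V : Type*}

/-- The leaders that are not centers of their star. -/
def starLeaves (l c : V → V) : Set V := {z | l z = z ∧ z ≠ c z}

variable (ch : Choices V) (j : ℕ) (R : Setoid V) {l : V → V}

theorem starEdges_eq_image (hl : ∀ x, l (l x) = l x) (hR : ∀ x, R x (l x)) :
    {e | ∃ x, l x ≠ ch.center j R l x ∧ e = s(l x, ch.center j R l x)} =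
      (fun z => s(z, ch.center j R l z)) '' starLeaves l (ch.center j R l) := by
  ext e
  constructor
  · rintro ⟨x, hx, rfl⟩
    have hc := ch.center_eq j R l _ _ (hR x)
    exact ⟨l x, ⟨hl x, hc ▸ hx⟩, by simp only [hc]⟩
  · rintro ⟨z, ⟨hz, hzc⟩, rfl⟩
    exact ⟨z, by rwa [hz], by rw [hz]⟩

/-- There is exactly one center per class of `R`; centers and leaves are disjoint sets of leaders.
-/
theorem ncard_starLeaves_add_le [Finite V] (hR : ∀ x, R x (l x)) :
    (starLeaves l (ch.center j R l)).ncard + Nat.card (Quotient R) ≤ (Set.range l).ncard := by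
  set c := ch.center j R l with hc
  have hcR : ∀ x, R x (c x) := by
    intro x
    obtain ⟨y, hy, he⟩ := ch.center_mem j R l x
    rw [hc, he]
    exact R.trans' hy (hR y)
  have hcc : ∀ x, c (c x) = c x := fun x => (ch.center_eq j R l _ _ (hcR x)).symm
  have hrange : Nat.card (Quotient R) = (Set.range c).ncard := by
    refine (ncard_range_eq_card_quotient fun x y => ⟨ch.center_eq j R l x y, fun h => ?_⟩).symm
    have h' : c x = c y := h
    refine R.trans' (hcR x) ?_
    rw [h']
    exact R.symm' (hcR y)
  have hd : Disjoint (starLeaves l c) (Set.range c) := by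
    rw [Set.disjoint_left]
    rintro _ ⟨-, hz⟩ ⟨x, rfl⟩
    exact hz (hcc x).symm
  rw [hrange, ← Set.ncard_union_eq hd (Set.toFinite _) (Set.toFinite _)]
  refine Set.ncard_le_ncard ?_ (Set.toFinite _)
  rintro z (⟨h, -⟩ | ⟨x, rfl⟩)
  · exact ⟨z, h⟩
  · obtain ⟨y, -, he⟩ := ch.center_mem j R l x
    exact ⟨y, he.symm⟩

/-- Suppose `R` is obtained by merging incomplete classes of a leader map `l'` that starts from a
finer partition than `l`. A leaf of a star is then an incomplete leader of `l`, or it lies in an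
incomplete class of `l'` in a way that these classes are different for different leaves. -/
theorem ncard_starLeaves_le_of_merge [Finite V] {G : SimpleGraph V} {l' : V → V} {R' : Setoid V}
    (hsep : ∀ z, ¬ Incomplete G l z → ∀ x y, l' x = l' y → (l x = z ↔ l y = z))
    (hR : R = mergeIncomplete G l' R') :
    (starLeaves l (ch.center j R l)).ncard ≤
      {z | Incomplete G l z}.ncard + {z | Incomplete G l' z}.ncard := by
  set c := ch.center j R l with hc
  set B : Set V := {z | z ∈ starLeaves l c ∧ ¬ Incomplete G l z} with hB
  have h1 : starLeaves l c ⊆ {z | Incomplete G l z} ∪ B := by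
    intro z hz
    by_cases h : Incomplete G l z
    · exact Or.inl h
    · exact Or.inr ⟨hz, h⟩
  have h2 : B.ncard ≤ {z | Incomplete G l' z}.ncard := by
    refine Set.ncard_le_ncard_of_injOn l' ?_ ?_ (Set.toFinite _)
    · rintro z ⟨⟨hz, hzc⟩, hcomp⟩
      obtain ⟨y, hy, he⟩ := ch.center_mem j R l z
      rw [hR] at hy
      rcases hy with hy | ⟨hy, -, -⟩
      -- The center is `l y`. If `z` and `y` share a class of `l'`, the complete class of `z`
      -- contains `y`, so `l y = z` and `z` would be its own center.
      · refine absurd ?_ hzc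
        have := (hsep z hcomp z y hy).mp hz
        rw [hc, he, this]
      · exact hy
    · rintro z ⟨⟨hz, -⟩, hcomp⟩ w ⟨⟨hw, -⟩, -⟩ hzw
      have := (hsep z hcomp z w hzw).mp hz
      rw [← this, hw]
  calc (starLeaves l c).ncard ≤ ({z | Incomplete G l z} ∪ B).ncard :=
        Set.ncard_le_ncard h1 (Set.toFinite _)
    _ ≤ {z | Incomplete G l z}.ncard + B.ncard := Set.ncard_union_le _ _
    _ ≤ _ := Nat.add_le_add_left h2 _

/-- A complete class of `l` contains every class of a leader map that starts from a finer
partition that it meets. -/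
theorem leaders_eq_iff_of_complete {G : SimpleGraph V} {s s' : Phase} {j' : ℕ}
    {coins coins' : ℕ → V → Bool} {P P' : Setoid V} {h h' : ℕ} (hP : P' ≤ P) {z : V}
    (hz : ¬ Incomplete G (leaders ch s j G coins P h) z) {x y : V}
    (hxy : leaders ch s' j' G coins' P' h' x = leaders ch s' j' G coins' P' h' y) :
    leaders ch s j G coins P h x = z ↔ leaders ch s j G coins P h y = z := by
  set l := leaders ch s j G coins P h with hl
  -- Two blocks, inside and outside the class of `z`. Completeness means that no edge crosses them,
  -- so compression from a finer partition cannot cross them either.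
  let S : Setoid V := Setoid.ker fun x => l x = z
  have hPS : P' ≤ S := fun u v huv => by
    change (l u = z) = (l v = z)
    rw [hl, leaders_eq_of_rel ch s j G coins P (hP huv)]
  have hGS : ∀ u v, G.Adj u v → S u v := by
    intro u v huv
    change (l u = z) = (l v = z)
    by_cases he : l u = l v
    · rw [he]
    · refine propext ⟨fun h1 => absurd ⟨u, v, huv, he, h1⟩ hz,
        fun h1 => absurd ⟨v, u, huv.symm, Ne.symm he, h1⟩ hz⟩
  have hr := leaders_rel ch s' j' coins' hPS hGS h'
  have : S x y := by
    refine S.trans' (hr x) ?_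
    rw [hxy]
    exact S.symm' (hr y)
  exact (show (l x = z) = (l y = z) from this).to_iff

end Stars

/-! ### The output is a spanning tree -/

section Tree

variable {d : ℕ} {X : Finset (EuclideanSpace ℝ (Fin d))} {Cs : ℝ} {p : Params}
  {sp : ℕ → Set X → SimpleGraph X} (ch : Choices X) (a : Fin d → ℝ) (ω : Coins X p)

/-- The number of components at level `2 ^ j`. -/
def hatCard (sp : ℕ → Set X → SimpleGraph X) (j : ℕ) : ℕ :=
  Nat.card (Quotient (hatPartition p sp ch a ω j))

/-- The leaves of the stars at level `2 ^ j`. -/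
def levelLeaves (sp : ℕ → Set X → SimpleGraph X) (j : ℕ) : Set X :=
  starLeaves (edgeLeaders p sp ch a ω j p.h)
    (ch.center j (hatPartition p sp ch a ω j) (edgeLeaders p sp ch a ω j p.h))

/-- The edges produced in round `i` at level `2 ^ j`. -/
def levelRound (sp : ℕ → Set X → SimpleGraph X) (j i : ℕ) : Set (Sym2 X) :=
  roundEdges ch .edges j (spannerGraph p sp a j) (coinsAt ω .edges j)
    (hatPartition p sp ch a ω (j - 1)) i

variable (hsp : ∀ j Y, IsTwoHopSpanner Cs (2 ^ j) Y (sp j Y))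

theorem edgeLeaders_idem (sp : ℕ → Set X → SimpleGraph X) (j i : ℕ) (x : X) :
    edgeLeaders p sp ch a ω j i (edgeLeaders p sp ch a ω j i x) = edgeLeaders p sp ch a ω j i x :=
  leaders_idem ..

/-- Connectivity by induction on the level: round edges join a point to its final leader, star edges
join the final leaders of a class. Applied with `S` the reachability relation of the output. -/
theorem hatPartition_rel_of_outputEdges {S : Setoid X}
    (hS : ∀ x y, s(x, y) ∈ outputEdges p sp ch a ω → S x y)
    (h0 : hatPartition p sp ch a ω 0 ≤ S) {j : ℕ} (hj : j ≤ p.top) :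
    hatPartition p sp ch a ω j ≤ S := by
  induction j with
  | zero => exact h0
  | succ j ih =>
    have ih := ih (by omega)
    have hlev : ∀ x y, s(x, y) ∈ levelEdges p sp ch a ω (j + 1) → S x y := by
      intro x y h
      refine hS x y ?_
      simp only [outputEdges, Set.mem_iUnion]
      exact ⟨j + 1, by simp; omega, h⟩
    have hl : ∀ x, S x (edgeLeaders p sp ch a ω (j + 1) p.h x) := by
      refine leaders_rel_of_roundEdges ch .edges (j + 1) _ _ _ ih p.h ?_
      intro i hi x y hxy
      exact hlev x y (Or.inl (Set.mem_iUnion.mpr ⟨⟨i, hi⟩, hxy⟩))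
    have hc : ∀ x, S x (ch.center (j + 1) (hatPartition p sp ch a ω (j + 1))
        (edgeLeaders p sp ch a ω (j + 1) p.h) x) := by
      intro x
      by_cases he : edgeLeaders p sp ch a ω (j + 1) p.h x =
          ch.center (j + 1) (hatPartition p sp ch a ω (j + 1))
            (edgeLeaders p sp ch a ω (j + 1) p.h) x
      · rw [← he]
        exact hl x
      · exact S.trans' (hl x) (hlev _ _ (Or.inr ⟨x, he, rfl⟩))
    intro x y hxy
    refine S.trans' (hc x) ?_
    rw [ch.center_eq _ _ _ _ _ hxy]
    exact S.symm' (hc y)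

include hsp

theorem hatPartition_edgeLeaders (j i : ℕ) (x : X) :
    hatPartition p sp ch a ω j x (edgeLeaders p sp ch a ω j i x) :=
  leaders_rel ch .edges j _ (hatPartition_mono ch a ω hsp (Nat.sub_le j 1))
    (fun _ _ h => hatPartition_of_adj ch a ω hsp h) i x

theorem hatPartition_center (j : ℕ) (x : X) :
    hatPartition p sp ch a ω j x (ch.center j (hatPartition p sp ch a ω j)
      (edgeLeaders p sp ch a ω j p.h) x) := by
  obtain ⟨y, hy, he⟩ := ch.center_mem j (hatPartition p sp ch a ω j)
    (edgeLeaders p sp ch a ω j p.h) x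
  rw [he]
  exact (hatPartition p sp ch a ω j).trans' hy (hatPartition_edgeLeaders ch a ω hsp j _ y)

theorem levelEdges_eq (j : ℕ) : levelEdges p sp ch a ω j =
    (⋃ i ∈ Finset.range p.h, levelRound ch a ω sp j i) ∪
      (fun z => s(z, ch.center j (hatPartition p sp ch a ω j)
        (edgeLeaders p sp ch a ω j p.h) z)) '' levelLeaves ch a ω sp j := by
  rw [levelLeaves, ← starEdges_eq_image ch j _ (edgeLeaders_idem ch a ω sp j p.h)
    (hatPartition_edgeLeaders ch a ω hsp j p.h)]
  unfold levelEdges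
  congr 1
  ext e
  simp only [Set.mem_iUnion, Finset.mem_range, exists_prop]
  exact ⟨fun ⟨i, hi⟩ => ⟨i, i.2, hi⟩, fun ⟨i, hi, he⟩ => ⟨⟨i, hi⟩, he⟩⟩

theorem ncard_levelLeaves_add_le (j : ℕ) :
    ∑ i ∈ Finset.range p.h, (levelRound ch a ω sp j i).ncard + (levelLeaves ch a ω sp j).ncard +
      hatCard ch a ω sp j ≤ hatCard ch a ω sp (j - 1) := by
  have h1 := ncard_starLeaves_add_le ch j (hatPartition p sp ch a ω j)
    (hatPartition_edgeLeaders ch a ω hsp j p.h)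
  have h2 := sum_ncard_roundEdges_add_le ch .edges j (spannerGraph p sp a j) (coinsAt ω .edges j)
    (hatPartition p sp ch a ω (j - 1)) p.h
  unfold levelRound levelLeaves hatCard
  unfold edgeLeaders at h1 ⊢
  omega

theorem ncard_levelEdges_add_le (j : ℕ) :
    (levelEdges p sp ch a ω j).ncard + hatCard ch a ω sp j ≤ hatCard ch a ω sp (j - 1) := by
  refine le_trans ?_ (ncard_levelLeaves_add_le ch a ω hsp j)
  rw [levelEdges_eq ch a ω hsp]
  refine Nat.add_le_add_right ((Set.ncard_union_le _ _).trans (add_le_add ?_ ?_)) _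
  · exact Finset.set_ncard_biUnion_le _ _
  · exact Set.ncard_image_le (Set.toFinite _)

/-- The level bounds telescope, since each level starts where the previous partition ended. -/
theorem ncard_outputEdges_add_le :
    (outputEdges p sp ch a ω).ncard + hatCard ch a ω sp p.top ≤ hatCard ch a ω sp 0 := by
  have key : ∀ m, ∑ j ∈ Finset.Icc 1 m, (levelEdges p sp ch a ω j).ncard + hatCard ch a ω sp m ≤
      hatCard ch a ω sp 0 := by
    intro m
    induction m with
    | zero => simp
    | succ m ih =>
      rw [Finset.sum_Icc_succ_top (by omega)]
      have := ncard_levelEdges_add_le ch a ω hsp (m + 1)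
      rw [Nat.add_sub_cancel] at this
      omega
  exact le_trans (Nat.add_le_add_right (Finset.set_ncard_biUnion_le _ _) _) (key p.top)

theorem not_isDiag_of_mem_outputEdges {e : Sym2 X} (he : e ∈ outputEdges p sp ch a ω) :
    ¬ e.IsDiag := by
  simp only [outputEdges, Set.mem_iUnion] at he
  obtain ⟨j, -, he⟩ := he
  rw [levelEdges_eq ch a ω hsp] at he
  rcases he with he | ⟨z, hz, rfl⟩
  · simp only [Set.mem_iUnion] at he
    obtain ⟨i, -, he⟩ := he
    exact SimpleGraph.not_isDiag_of_mem_edgeSet _ (adj_of_mem_roundEdges _ _ _ _ _ _ he)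
  · exact hz.2

theorem isSpanningTree_outputEdges [Nonempty X] (h0 : hatPartition p sp ch a ω 0 = ⊥)
    (htop : hatPartition p sp ch a ω p.top = ⊤) :
    IsSpanningTree (outputEdges p sp ch a ω) := by
  set T := SimpleGraph.fromEdgeSet (outputEdges p sp ch a ω) with hT
  have hedge : T.edgeSet = outputEdges p sp ch a ω := by
    rw [hT, SimpleGraph.edgeSet_fromEdgeSet, sdiff_eq_left, Set.disjoint_left]
    exact fun e he => not_isDiag_of_mem_outputEdges ch a ω hsp he
  have hconn : T.Connected := by
    have := hatPartition_rel_of_outputEdges ch a ω (S := T.reachableSetoid) (fun x y h => ?_)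
      (h0 ▸ bot_le) le_rfl
    · rw [htop] at this
      exact ⟨fun x y => this (Setoid.top_def ▸ trivial)⟩
    · exact SimpleGraph.Adj.reachable (by rwa [← SimpleGraph.mem_edgeSet, hedge])
  refine ⟨T, SimpleGraph.isTree_iff_connected_and_card.mpr ⟨hconn, ?_⟩, hedge⟩
  -- Connectedness gives one inequality, the edge count the other; acyclicity is never shown
  -- directly.
  refine le_antisymm ?_ hconn.card_vert_le_card_edgeSet_add_one
  rw [hedge, Nat.card_coe_set_eq]
  have : Nonempty (Quotient (hatPartition p sp ch a ω p.top)) :=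
    ⟨Quotient.mk _ (Classical.arbitrary X)⟩
  have hn : 1 ≤ hatCard ch a ω sp p.top := Nat.card_pos
  have hle : hatCard ch a ω sp 0 ≤ Nat.card X :=
    Nat.card_le_card_of_surjective (Quotient.mk _) Quotient.mk_surjective
  have := ncard_outputEdges_add_le ch a ω hsp
  omega

end Tree

/-! ### The partitions at the lowest and highest levels -/

section TreeEnds

variable {d : ℕ} {X : Finset (EuclideanSpace ℝ (Fin d))} {Cs : ℝ} {p : Params}
  {sp : ℕ → Set X → SimpleGraph X} (ch : Choices X) (a : Fin d → ℝ) (ω : Coins X p)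
  (hsp : ∀ j Y, IsTwoHopSpanner Cs (2 ^ j) Y (sp j Y))
include hsp

theorem hatPartition_zero_eq_bot {δ : ℝ}
    (hδ : ∀ x ∈ X, ∀ y ∈ X, x ≠ y → δ ≤ dist x y) (hd : d * p.side 0 < δ) (hCs : Cs < δ)
    (hCs0 : 0 ≤ Cs) : hatPartition p sp ch a ω 0 = ⊥ := by
  have hcell : cellPartition X a (p.side 0) = ⊥ := by
    refine le_antisymm (fun x y h => ?_) bot_le
    by_contra hne
    have h1 := dist_le_of_cellIdx_eq (p.side_pos 0) h
    have h2 := hδ x x.2 y y.2 fun h' => hne (Subtype.ext h')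
    linarith
  have hG : ∀ x y, ¬ (spannerGraph p sp a (0 * 2 ^ p.g)).Adj x y := by
    intro x y h
    have h1 := dist_le_of_spannerGraph_adj hCs0 hsp h
    have h2 := hδ x x.2 y y.2 fun h' => h.ne (Subtype.ext h')
    simp only [zero_mul, pow_zero, mul_one] at h1
    linarith
  have h := hatPartition_mul ch a ω sp 0
  rw [zero_mul] at h hG
  rw [h, hcell]
  have hl := leaders_rel ch .components 0 (coinsAt ω .components 0)
    (le_refl (⊥ : Setoid X)) (G := spannerGraph p sp a 0) (fun x y h' => absurd h' (hG x y)) p.h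
  refine le_antisymm (fun x y hxy => ?_) bot_le
  rcases hxy with hxy | ⟨⟨u, v, huv, -, -⟩, -, -⟩
  · have h1 : x = leaders ch .components 0 (spannerGraph p sp a 0) (coinsAt ω .components 0)
      ⊥ p.h x := hl x
    have h2 : y = leaders ch .components 0 (spannerGraph p sp a 0) (coinsAt ω .components 0)
      ⊥ p.h y := hl y
    exact h1.trans (hxy.trans h2.symm)
  · exact absurd huv (hG u v)

theorem hatPartition_top_eq_top {Δ : ℝ} (hX : ∀ x ∈ X, ∀ i, x i ∈ Set.Icc (0 : ℝ) Δ)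
    (ha : ∀ i, a i ∈ Set.Ico (0 : ℝ) Δ) (hΔ : 2 * Δ ≤ p.side (p.H + 1))
    (hdiam : ∀ x ∈ X, ∀ y ∈ X, dist x y ≤ p.α ^ p.H) :
    hatPartition p sp ch a ω p.top = ⊤ := by
  have hidx : p.idx p.top = p.H := p.idx_mul p.H
  have hzero : ∀ x : X, cellIdx a (p.side (p.H + 1)) x = 0 := by
    intro x
    funext i
    have h1 := hX x x.2 i
    have h2 := ha i
    refine Int.floor_eq_iff.mpr ⟨?_, ?_⟩
    · have := h1.1
      have := h2.1
      have := p.side_pos (p.H + 1)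
      simp only [Pi.zero_apply, Int.cast_zero]
      positivity
    · rw [div_lt_iff₀ (p.side_pos _)]
      simp only [Pi.zero_apply, Int.cast_zero, zero_add, one_mul]
      linarith [h1.2, h2.2]
  refine le_antisymm le_top fun x y _ => ?_
  refine spannerGraph_rel_of_close (p := p) (a := a) (j := p.top) hsp ?_ ?_
    (fun u v h => hatPartition_of_adj ch a ω hsp h)
  · rw [hidx]
    exact (hzero x).trans (hzero y).symm
  · refine (hdiam x x.2 y y.2).trans (le_of_eq ?_)
    rw [Params.α, Params.top, ← pow_mul, mul_comm]

end TreeEnds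

/-! ### The weight of a level -/

section Weight

variable {d : ℕ} {X : Finset (EuclideanSpace ℝ (Fin d))}

theorem edgeLen_nonneg (e : Sym2 X) : 0 ≤ edgeLen e := by
  induction e using Sym2.ind
  exact dist_nonneg (α := EuclideanSpace ℝ (Fin d))

theorem weight_nonneg (E : Set (Sym2 X)) : 0 ≤ weight E := by
  classical
  refine Finset.sum_nonneg fun e _ => ?_
  split_ifs
  exacts [edgeLen_nonneg e, le_rfl]

theorem weight_union_le (A B : Set (Sym2 X)) : weight (A ∪ B) ≤ weight A + weight B := by
  classical
  simp only [weight]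
  rw [← Finset.sum_add_distrib]
  refine Finset.sum_le_sum fun e _ => ?_
  have := edgeLen_nonneg e
  by_cases h1 : e ∈ A <;> by_cases h2 : e ∈ B <;> simp [h1, h2, this]

theorem weight_biUnion_le {ι : Type*} (s : Finset ι) (A : ι → Set (Sym2 X)) :
    weight (⋃ i ∈ s, A i) ≤ ∑ i ∈ s, weight (A i) := by
  classical
  induction s using Finset.induction_on with
  | empty => simp [weight]
  | insert i s hi ih =>
    rw [Finset.set_biUnion_insert, Finset.sum_insert hi]
    exact (weight_union_le _ _).trans (by gcongr)

theorem weight_le_ncard_mul {E : Set (Sym2 X)} {c : ℝ} (h : ∀ e ∈ E, edgeLen e ≤ c) :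
    weight E ≤ E.ncard * c := by
  classical
  simp only [weight]
  rw [← Finset.sum_filter, Set.ncard_eq_toFinset_card', ← nsmul_eq_mul]
  refine (Finset.sum_le_card_nsmul _ _ c fun e he => h e (by simpa using he)).trans (le_of_eq ?_)
  congr 2
  ext e
  simp

variable {Cs : ℝ} {p : Params} {sp : ℕ → Set X → SimpleGraph X} (ch : Choices X)
  (a : Fin d → ℝ) (ω : Coins X p)

/-- The partition from which the component phase at level `2 ^ j` starts. -/
def startPartition (sp : ℕ → Set X → SimpleGraph X) (j : ℕ) : Setoid X :=
  if 2 ^ p.g ∣ j then cellPartition X a (p.side (j / 2 ^ p.g))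
  else hatPartition p sp ch a ω (j - 2 ^ padicValNat 2 j)

/-- The leaders that are still incomplete after `i` rounds of phase `s` at level `2 ^ j`, starting
from `P`. -/
def incompleteLeaders (sp : ℕ → Set X → SimpleGraph X) (s : Phase) (j : ℕ) (P : Setoid X)
    (i : ℕ) : Set X :=
  {z | Incomplete (spannerGraph p sp a j)
    (leaders ch s j (spannerGraph p sp a j) (coinsAt ω s j) P i) z}

theorem exists_hatPartition_eq (sp : ℕ → Set X → SimpleGraph X) (j : ℕ) :
    ∃ R, hatPartition p sp ch a ω j = mergeIncomplete (spannerGraph p sp a j)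
      (leaders ch .components j (spannerGraph p sp a j) (coinsAt ω .components j)
        (startPartition ch a ω sp j) p.h) R := by
  rw [hatPartition, startPartition]
  split_ifs
  · exact ⟨_, rfl⟩
  · exact ⟨_, rfl⟩

variable (hsp : ∀ j Y, IsTwoHopSpanner Cs (2 ^ j) Y (sp j Y))
include hsp

theorem cellPartition_le_startPartition {j : ℕ} (hj : 1 ≤ j) :
    cellPartition X a (p.side (p.idx j - 1)) ≤ startPartition ch a ω sp j := by
  unfold startPartition
  split_ifs with h
  · obtain ⟨k, rfl⟩ := h
    rw [Nat.mul_div_cancel_left _ (by positivity), mul_comm, p.idx_mul]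
    exact cellPartition_side_mono p X a (Nat.sub_le k 1)
  · refine cellPartition_le_hatPartition ch a ω hsp ?_
    -- Both `j` and `(p.idx j - 1) * 2 ^ p.g` are multiples of `2 ^ padicValNat 2 j`, so stepping
    -- back by that amount does not pass the preceding power of `α`.
    have hv : padicValNat 2 j < p.g := by
      by_contra hc
      exact h ((pow_dvd_pow 2 (not_lt.mp hc)).trans pow_padicValNat_dvd)
    have h1 := (p.idx_pred_mul_lt hj).2
    have h2 : 2 ^ padicValNat 2 j ∣ (p.idx j - 1) * 2 ^ p.g :=
      (pow_dvd_pow 2 hv.le).trans (Dvd.intro_left _ rfl)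
    have h3 : 2 ^ padicValNat 2 j ∣ j := pow_padicValNat_dvd
    have h4 := Nat.le_of_dvd (by omega) (Nat.dvd_sub h3 h2)
    omega

theorem cellPartition_le_hatPartition_pred {j : ℕ} (hj : 1 ≤ j) :
    cellPartition X a (p.side (p.idx j - 1)) ≤ hatPartition p sp ch a ω (j - 1) :=
  cellPartition_le_hatPartition ch a ω hsp (by have := (p.idx_pred_mul_lt hj).2; omega)

/-- Needed to compare the two compression phases. Away from powers of `α` it is monotonicity. At `α
^ k` the starting cells have diameter at most `d * α ^ k / β ≤ α ^ k / 2`, so the spanner of the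
previous level already joins their points. -/
theorem startPartition_le_hatPartition_pred {j : ℕ} (hj : 1 ≤ j) (hg : 1 ≤ p.g)
    (hd : 2 * (d : ℝ) ≤ p.β) :
    startPartition ch a ω sp j ≤ hatPartition p sp ch a ω (j - 1) := by
  unfold startPartition
  split_ifs with h
  · obtain ⟨k, rfl⟩ := h
    rw [Nat.mul_div_cancel_left _ (by positivity), mul_comm]
    have hk : 1 ≤ k := by
      rcases k with _ | k
      · simp at hj
      · omega
    have h2g : 2 ≤ 2 ^ p.g := by
      calc 2 = 2 ^ 1 := rfl
        _ ≤ 2 ^ p.g := Nat.pow_le_pow_right (by norm_num) hg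
    -- With `2 ^ p.g ≥ 2` the exponent just below that of `α ^ k` still has index `k`, so its
    -- spanners live on cells of side `α ^ (k + 1) / β`.
    have hidx : p.idx (k * 2 ^ p.g - 1) = k := by
      have h1 : k * 2 ^ p.g - 1 + 2 ^ p.g - 1 = (2 ^ p.g - 2) + k * 2 ^ p.g := by
        have : 1 ≤ k * 2 ^ p.g := Nat.mul_pos hk (by positivity)
        omega
      rw [Params.idx, h1, Nat.add_mul_div_right _ _ (by positivity),
        Nat.div_eq_of_lt (by omega), zero_add]
    intro x y hxy
    refine spannerGraph_rel_of_close (p := p) (a := a) (j := k * 2 ^ p.g - 1) hsp ?_ ?_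
      (fun u v h => hatPartition_of_adj ch a ω hsp h)
    · rw [hidx]
      exact cellPartition_side_mono p X a k.le_succ hxy
    · have h1 := dist_le_of_cellIdx_eq (p.side_pos k) hxy
      have h2 : (2 : ℝ) ^ (k * 2 ^ p.g - 1) * 2 = p.α ^ k := by
        rw [← pow_succ, Nat.sub_add_cancel (Nat.mul_pos hk (by positivity)), Params.α, ← pow_mul,
          mul_comm]
      have h3 : (d : ℝ) * p.side k * 2 ≤ p.α ^ k := by
        rw [Params.side, mul_div_assoc', div_mul_eq_mul_div, div_le_iff₀ p.β_pos]
        have := pow_pos p.α_pos k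
        nlinarith
      linarith
  · refine hatPartition_mono ch a ω hsp ?_
    have : 0 < 2 ^ padicValNat 2 j := by positivity
    omega

theorem ncard_levelLeaves_le {j : ℕ} (hj : 1 ≤ j) (hg : 1 ≤ p.g) (hd : 2 * (d : ℝ) ≤ p.β) :
    (levelLeaves ch a ω sp j).ncard ≤
      (incompleteLeaders ch a ω sp .edges j (hatPartition p sp ch a ω (j - 1)) p.h).ncard +
      (incompleteLeaders ch a ω sp .components j (startPartition ch a ω sp j) p.h).ncard := by
  obtain ⟨R, hR⟩ := exists_hatPartition_eq ch a ω sp j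
  exact ncard_starLeaves_le_of_merge ch j _
    (fun z hz x y hxy => leaders_eq_iff_of_complete ch j
      (startPartition_le_hatPartition_pred ch a ω hsp hj hg hd) hz hxy) hR

/-- Round edges are spanner edges, hence short. A star edge stays in one class of `hatPartition`,
hence in one cell, which bounds its length by the cell diameter. -/
theorem weight_levelEdges_le [Nonempty X] (hCs : 0 ≤ Cs) {j : ℕ} (hj : 1 ≤ j) (hg : 1 ≤ p.g)
    (hd : 2 * (d : ℝ) ≤ p.β) :
    weight (levelEdges p sp ch a ω j) ≤
      Cs * 2 ^ j * ((hatCard ch a ω sp (j - 1) : ℝ) - 1) +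
      d * p.side (p.idx j + 1) *
        ((incompleteLeaders ch a ω sp .edges j (hatPartition p sp ch a ω (j - 1)) p.h).ncard +
        (incompleteLeaders ch a ω sp .components j (startPartition ch a ω sp j) p.h).ncard) := by
  rw [levelEdges_eq ch a ω hsp]
  refine (weight_union_le _ _).trans (add_le_add ?_ ?_)
  · have hround : ∀ i ∈ Finset.range p.h, weight (levelRound ch a ω sp j i) ≤
        (levelRound ch a ω sp j i).ncard * (Cs * 2 ^ j) := by
      intro i _
      refine weight_le_ncard_mul fun e he => ?_
      have := adj_of_mem_roundEdges _ _ _ _ _ _ he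
      induction e using Sym2.ind with
      | _ x y => exact dist_le_of_spannerGraph_adj hCs hsp this
    refine (weight_biUnion_le _ _).trans ((Finset.sum_le_sum hround).trans ?_)
    rw [← Finset.sum_mul, mul_comm]
    refine mul_le_mul_of_nonneg_left ?_ (by positivity)
    have h1 := ncard_levelLeaves_add_le ch a ω hsp j
    have : Nonempty (Quotient (hatPartition p sp ch a ω j)) :=
      ⟨Quotient.mk _ (Classical.arbitrary X)⟩
    have h2 : 1 ≤ hatCard ch a ω sp j := Nat.card_pos
    rw [← Nat.cast_sum, le_sub_iff_add_le]
    exact_mod_cast (by omega : _ + 1 ≤ hatCard ch a ω sp (j - 1))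
  · refine (weight_le_ncard_mul (c := d * p.side (p.idx j + 1)) ?_).trans ?_
    · rintro _ ⟨z, hz, rfl⟩
      exact dist_le_of_cellIdx_eq (p.side_pos _)
        (hatPartition_le_cellPartition ch a ω hsp j (hatPartition_center ch a ω hsp j z))
    · rw [mul_comm]
      refine mul_le_mul_of_nonneg_left ?_ (mul_nonneg (Nat.cast_nonneg _) (p.side_pos _).le)
      exact_mod_cast (Set.ncard_image_le (Set.toFinite _)).trans
        (ncard_levelLeaves_le ch a ω hsp hj hg hd)

end Weight

/-! ### Random coins: the number of incomplete components shrinks geometrically -/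

section OneRound

variable {V : Type*} [Fintype V]

theorem four_mul_card_coin_pair [DecidableEq V] {z w : V} (hzw : z ≠ w) :
    4 * (Finset.univ.filter fun c : V → Bool => c z = false ∧ c w = true).card =
      Fintype.card (V → Bool) := by
  have h1 : (Finset.univ.filter fun c : V → Bool => c z = false ∧ c w = true) =
      Fintype.piFinset fun v => if v = z then {false} else if v = w then {true} else Finset.univ := by
    ext c
    simp only [Finset.mem_filter, Finset.mem_univ, true_and, Fintype.mem_piFinset]
    constructor
    · rintro ⟨h1, h2⟩ v
      split_ifs with hz hw
      · simp [hz, h1]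
      · simp [hw, h2]
      · simp
    · intro h
      have hz := h z
      have hw := h w
      rw [if_pos rfl] at hz
      rw [if_neg hzw.symm, if_pos rfl] at hw
      simpa using And.intro hz hw
  -- Each factor is scaled up to 2, and the scalings multiply to 4; this replaces a division in `ℕ`.
  have h2 : ∀ v : V, (if v = z then {false} else if v = w then {true} else
      (Finset.univ : Finset Bool)).card * (if v = z then 2 else 1) * (if v = w then 2 else 1) = 2 := by
    intro v
    by_cases hz : v = z
    · simp [hz, hzw]
    · by_cases hw : v = w <;> simp [hz, hw, hzw.symm]
  rw [h1, Fintype.card_piFinset, Fintype.card_pi]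
  simp only [Fintype.card_bool]
  rw [← Finset.prod_congr rfl fun v _ => h2 v, Finset.prod_mul_distrib, Finset.prod_mul_distrib,
    Finset.prod_ite_eq', Finset.prod_ite_eq']
  simp only [Finset.mem_univ, if_true]
  ring

/-- In one round with fair coins, at most three quarters of the incomplete components remain
incomplete, in expectation. -/
theorem sum_ncard_incomplete_compress_le [DecidableEq V] {G : SimpleGraph V} {l : V → V}
    (hl : ∀ x, l (l x) = l x)
    (sel : (V → Bool) → V → V × V) (hs : ∀ c, IsSelection G l c (sel c)) :
    4 * ∑ c : V → Bool, {z | Incomplete G (compress G (sel c) l c) z}.ncard ≤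
      3 * (Fintype.card (V → Bool) * {z | Incomplete G l z}.ncard) := by
  classical
  set I : Finset V := Finset.univ.filter fun z => Incomplete G l z with hI
  have hcard : {z | Incomplete G l z}.ncard = I.card := by
    rw [Set.ncard_eq_toFinset_card']
    congr 1
    ext z
    simp [hI]
  have h1 : ∀ c : V → Bool, {z | Incomplete G (compress G (sel c) l c) z}.ncard ≤
      ∑ z ∈ I, if (messages G l c z).Nonempty then 0 else 1 := by
    intro c
    rw [Finset.sum_ite, Finset.sum_const_zero, zero_add, Finset.sum_const, smul_eq_mul, mul_one,
      ← Set.ncard_coe_finset]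
    refine Set.ncard_le_ncard ?_ (Set.toFinite _)
    intro z hz
    have := Incomplete.of_compress hl (hs c) hz
    simpa [hI] using this
  -- An edge leaves the part of `z` for another part. When `z` draws 0 and the other leader draws 1,
  -- `z` has a message and disappears. The event does not involve `sel`, which may therefore depend
  -- on all coins.
  have h2 : ∀ z ∈ I, 4 * ∑ c : V → Bool, (if (messages G l c z).Nonempty then 0 else 1) ≤
      3 * Fintype.card (V → Bool) := by
    intro z hz
    obtain ⟨x, y, hxy, hne, hx⟩ := (Finset.mem_filter.mp hz).2
    rw [hx] at hne
    have h3 := four_mul_card_coin_pair hne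
    have h4 : ∑ c : V → Bool, (if (messages G l c z).Nonempty then 0 else 1) +
        (Finset.univ.filter fun c : V → Bool => c z = false ∧ c (l y) = true).card ≤
        Fintype.card (V → Bool) := by
      rw [Finset.card_filter, ← Finset.sum_add_distrib, ← Finset.card_univ,
        Finset.card_eq_sum_ones]
      refine Finset.sum_le_sum fun c _ => ?_
      by_cases hm : (messages G l c z).Nonempty
      · rw [if_pos hm]
        split_ifs <;> simp
      · rw [if_neg hm, if_neg]
        rintro ⟨h5, h6⟩
        exact hm ⟨(y, x), hxy.symm, hx, h6, h5⟩
    omega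
  calc 4 * ∑ c : V → Bool, {z | Incomplete G (compress G (sel c) l c) z}.ncard
      ≤ 4 * ∑ c : V → Bool, ∑ z ∈ I, (if (messages G l c z).Nonempty then 0 else 1) := by
        gcongr with c
        exact h1 c
    _ = ∑ z ∈ I, 4 * ∑ c : V → Bool, (if (messages G l c z).Nonempty then 0 else 1) := by
        rw [Finset.sum_comm, Finset.mul_sum]
    _ ≤ ∑ _z ∈ I, 3 * Fintype.card (V → Bool) := Finset.sum_le_sum h2
    _ = _ := by
        rw [Finset.sum_const, smul_eq_mul, hcard]
        ring

end OneRound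

/-! ### Independence of the rounds, by resampling coins -/

section AllRounds

variable {d : ℕ} {X : Finset (EuclideanSpace ℝ (Fin d))} {p : Params}

open Classical in
/-- Flip the coins `c` of round `i` of phase `s` at level `j`. -/
def flipRound (s : Phase) (j : Fin (p.top + 1)) (i : Fin p.h) (c : X → Bool) (ω : Coins X p) :
    Coins X p :=
  fun q => if q.1 = s ∧ q.2.1 = j ∧ q.2.2.1 = i then xor (ω q) (c q.2.2.2) else ω q

theorem flipRound_involutive (s : Phase) (j : Fin (p.top + 1)) (i : Fin p.h) (c : X → Bool) :
    Function.Involutive (flipRound s j i c) := by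
  intro ω
  funext q
  unfold flipRound
  split_ifs with h
  · simp
  · rfl

theorem coinsAt_flipRound_self (s : Phase) (j : Fin (p.top + 1)) (i : Fin p.h) (c : X → Bool)
    (ω : Coins X p) :
    coinsAt (flipRound s j i c ω) s j i = fun x => xor (coinsAt ω s j i x) (c x) := by
  funext x
  simp only [coinsAt, flipRound, dif_pos j.2, dif_pos i.2, Fin.eta, and_self, if_true]

theorem coinsAt_flipRound_of_ne (s : Phase) (j : Fin (p.top + 1)) (i : Fin p.h) (c : X → Bool)
    (ω : Coins X p) {i' : ℕ} (hi : i' ≠ i) :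
    coinsAt (flipRound s j i c ω) s j i' = coinsAt ω s j i' := by
  funext x
  simp only [coinsAt, flipRound]
  split_ifs with h1 h2 h3
  · exact absurd (congrArg Fin.val h3.2.2) hi
  all_goals rfl

variable (sp : ℕ → Set X → SimpleGraph X) (ch : Choices X) (a : Fin d → ℝ)

-- Independence as a bijection: xoring the coins of one round with a fixed vector permutes the
-- outcomes, so that round may be resampled uniformly. `hP` ensures that the initial partition does
-- not see the resampled coins.
open Classical in
theorem four_mul_sum_incompleteLeaders_succ_le (s : Phase) (j : Fin (p.top + 1)) (i : Fin p.h)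
    (P : Coins X p → Setoid X)
    (hP : ∀ ω ω' : Coins X p, (∀ q, ¬ (q.1 = s ∧ q.2.1 = j) → ω q = ω' q) → P ω = P ω') :
    4 * ∑ ω, (incompleteLeaders ch a ω sp s j (P ω) (i + 1)).ncard ≤
      3 * ∑ ω, (incompleteLeaders ch a ω sp s j (P ω) i).ncard := by
  classical
  set Φ : Coins X p → ℕ := fun ω => (incompleteLeaders ch a ω sp s j (P ω) (i + 1)).ncard with hΦ
  set N := Fintype.card (X → Bool) with hN
  have hNpos : 0 < N := Fintype.card_pos
  have hsum : N * ∑ ω, Φ ω = ∑ ω, ∑ c : X → Bool, Φ (flipRound s j i c ω) := by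
    rw [Finset.sum_comm]
    have : ∀ c : X → Bool, ∑ ω, Φ (flipRound s j i c ω) = ∑ ω, Φ ω := fun c =>
      Equiv.sum_comp (flipRound_involutive s j i c).toPerm Φ
    simp only [this]
    rw [Finset.sum_const, smul_eq_mul, Finset.card_univ]
  -- For fixed `ω` the earlier rounds and the initial partition are unaffected, and the new coins
  -- run over all vectors once; the one-round bound applies.
  have hone : ∀ ω, 4 * ∑ c : X → Bool, Φ (flipRound s j i c ω) ≤
      3 * (N * (incompleteLeaders ch a ω sp s j (P ω) i).ncard) := by
    intro ω
    set G := spannerGraph p sp a j with hG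
    set l := leaders ch s j G (coinsAt ω s j) (P ω) i with hl
    have h1 : ∀ c : X → Bool, Φ (flipRound s j i c ω) =
        {z | Incomplete G (compress G (ch.message s j i G l
          (fun x => xor (coinsAt ω s j i x) (c x))) l
          (fun x => xor (coinsAt ω s j i x) (c x))) z}.ncard := by
      intro c
      have hP' : P (flipRound s j i c ω) = P ω := by
        refine hP _ _ fun q hq => ?_
        unfold flipRound
        rw [if_neg fun h => hq ⟨h.1, h.2.1⟩]
      have hl' : leaders ch s j G (coinsAt (flipRound s j i c ω) s j) (P ω) i = l :=
        leaders_congr ch s j G (P ω) i fun i' hi' => coinsAt_flipRound_of_ne s j i c ω hi'.ne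
      simp only [hΦ, incompleteLeaders, hP', leaders, ← hG, hl', coinsAt_flipRound_self]
    simp only [h1]
    let F : (X → Bool) → ℕ := fun c =>
      {z | Incomplete G (compress G (ch.message s j i G l c) l c) z}.ncard
    have h2 : ∑ c : X → Bool, F (fun x => xor (coinsAt ω s j i x) (c x)) = ∑ c, F c := by
      have hinv : Function.Involutive
          (fun (c : X → Bool) => fun x => xor (coinsAt ω s j i x) (c x)) := by
        intro c
        funext x
        simp
      exact Equiv.sum_comp hinv.toPerm F
    rw [show (∑ c : X → Bool, {z | Incomplete G (compress G (ch.message s j i G l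
          (fun x => xor (coinsAt ω s j i x) (c x))) l
          (fun x => xor (coinsAt ω s j i x) (c x))) z}.ncard) = ∑ c, F c from h2]
    exact sum_ncard_incomplete_compress_le (leaders_idem ch s j G _ (P ω) i)
      (fun c => ch.message s j i G l c) fun c => isSelection_message ch s j G i l c
  refine Nat.le_of_mul_le_mul_left ?_ hNpos
  calc N * (4 * ∑ ω, Φ ω) = ∑ ω, 4 * ∑ c : X → Bool, Φ (flipRound s j i c ω) := by
        rw [← Finset.mul_sum, ← hsum]
        ring
    _ ≤ ∑ ω, 3 * (N * (incompleteLeaders ch a ω sp s j (P ω) i).ncard) :=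
        Finset.sum_le_sum fun ω _ => hone ω
    _ = _ := by
        rw [← Finset.mul_sum, ← Finset.mul_sum]
        ring

open Classical in
theorem sum_incompleteLeaders_le (s : Phase) (j : Fin (p.top + 1))
    (P : Coins X p → Setoid X)
    (hP : ∀ ω ω' : Coins X p, (∀ q, ¬ (q.1 = s ∧ q.2.1 = j) → ω q = ω' q) → P ω = P ω')
    {i : ℕ} (hi : i ≤ p.h) :
    (∑ ω, ((incompleteLeaders ch a ω sp s j (P ω) i).ncard : ℝ)) ≤
      (3 / 4) ^ i * ∑ ω, ((incompleteLeaders ch a ω sp s j (P ω) 0).ncard : ℝ) := by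
  induction i with
  | zero => simp
  | succ i ih =>
    have h1 : (4 : ℝ) * ∑ ω, ((incompleteLeaders ch a ω sp s j (P ω) (i + 1)).ncard : ℝ) ≤
        3 * ∑ ω, ((incompleteLeaders ch a ω sp s j (P ω) i).ncard : ℝ) := by
      exact_mod_cast four_mul_sum_incompleteLeaders_succ_le sp ch a s j ⟨i, hi⟩ P hP
    have h2 := ih (by omega)
    rw [pow_succ]
    linarith

open Classical in
/-- The average over the coins of the number of incomplete components after all rounds, when the
initial partition is coarser than `Q`. -/
theorem sum_incompleteLeaders_le_card (s : Phase) (j : Fin (p.top + 1))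
    (P : Coins X p → Setoid X)
    (hP : ∀ ω ω' : Coins X p, (∀ q, ¬ (q.1 = s ∧ q.2.1 = j) → ω q = ω' q) → P ω = P ω')
    (Q : Setoid X) (hQ : ∀ ω, Q ≤ P ω) :
    (∑ ω, ((incompleteLeaders ch a ω sp s j (P ω) p.h).ncard : ℝ)) ≤
      Fintype.card (Coins X p) * ((3 / 4) ^ p.h * (2 * ((Nat.card (Quotient Q) - 1 : ℕ) : ℝ))) := by
  refine (sum_incompleteLeaders_le sp ch a s j P hP le_rfl).trans ?_
  have h : ∀ ω ∈ Finset.univ, ((incompleteLeaders ch a ω sp s j (P ω) 0).ncard : ℝ) ≤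
      2 * ((Nat.card (Quotient Q) - 1 : ℕ) : ℝ) := by
    intro ω _
    have h1 := ncard_incomplete_le ch s j (spannerGraph p sp a j) (coinsAt ω s j) (P ω)
    have h2 := card_quotient_le_of_le (hQ ω)
    exact_mod_cast h1.trans (by omega)
  have := Finset.sum_le_card_nsmul _ _ _ h
  rw [nsmul_eq_mul, Finset.card_univ] at this
  calc _ ≤ (3 / 4 : ℝ) ^ p.h * (Fintype.card (Coins X p) *
        (2 * ((Nat.card (Quotient Q) - 1 : ℕ) : ℝ))) :=
        mul_le_mul_of_nonneg_left this (by positivity)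
    _ = _ := by ring

/-- The depth of the recursion that defines the partition at level `2 ^ j`. -/
def levelRank (p : Params) (j : ℕ) : ℕ := if 2 ^ p.g ∣ j then 0 else p.g - padicValNat 2 j

theorem levelRank_lt {j i : ℕ} (hj : ¬ 2 ^ p.g ∣ j) (hi : 2 ^ (padicValNat 2 j + 1) ∣ i) :
    levelRank p i < levelRank p j := by
  unfold levelRank
  convert rank_lt hj hi

theorem hatPartition_congr {ω ω' : Coins X p} {j : ℕ}
    (h : ∀ i, levelRank p i ≤ levelRank p j →
      coinsAt ω .components i = coinsAt ω' .components i) :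
    hatPartition p sp ch a ω j = hatPartition p sp ch a ω' j := by
  induction hr : levelRank p j using Nat.strong_induction_on generalizing j with
  | _ r ih =>
    subst hr
    by_cases hj : 2 ^ p.g ∣ j
    · obtain ⟨k, rfl⟩ := hj
      rw [mul_comm] at h ⊢
      rw [hatPartition_mul, hatPartition_mul, h _ le_rfl]
    · have h0 : j ≠ 0 := by
        rintro rfl
        exact hj (dvd_zero _)
      have l1 := levelRank_lt hj (pow_succ_dvd_sub_and_add h0).1
      have l2 := levelRank_lt hj (pow_succ_dvd_sub_and_add h0).2
      rw [hatPartition_of_not_dvd ch a ω sp hj, hatPartition_of_not_dvd ch a ω' sp hj, h _ le_rfl,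
        ih _ l1 (fun i hi => h i (hi.trans l1.le)) rfl,
        ih _ l2 (fun i hi => h i (hi.trans l2.le)) rfl]

theorem coinsAt_congr {ω ω' : Coins X p} {s : Phase} {j : Fin (p.top + 1)}
    (h : ∀ q, ¬ (q.1 = s ∧ q.2.1 = j) → ω q = ω' q) {s' : Phase} {j' : ℕ}
    (hne : ¬ (s' = s ∧ j' = j)) : coinsAt ω s' j' = coinsAt ω' s' j' := by
  funext i x
  unfold coinsAt
  split_ifs with h1 h2
  · exact h _ fun hc => hne ⟨hc.1, congrArg Fin.val hc.2⟩
  all_goals rfl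

theorem hatPartition_congr_edges {ω ω' : Coins X p} {j : Fin (p.top + 1)}
    (h : ∀ q, ¬ (q.1 = .edges ∧ q.2.1 = j) → ω q = ω' q) (i : ℕ) :
    hatPartition p sp ch a ω i = hatPartition p sp ch a ω' i :=
  hatPartition_congr sp ch a fun _ _ => coinsAt_congr h (by simp)

/-- The starting partition has strictly smaller `levelRank`, so its recursion never reads the
component coins of level `j` itself. -/
theorem startPartition_congr_components {ω ω' : Coins X p} {j : Fin (p.top + 1)}
    (h : ∀ q, ¬ (q.1 = .components ∧ q.2.1 = j) → ω q = ω' q) :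
    startPartition ch a ω sp j = startPartition ch a ω' sp j := by
  unfold startPartition
  split_ifs with hj
  · rfl
  · have h0 : (j : ℕ) ≠ 0 := fun h0 => hj (h0 ▸ dvd_zero _)
    have l1 := levelRank_lt hj (pow_succ_dvd_sub_and_add h0).1
    refine hatPartition_congr sp ch a fun i hi => coinsAt_congr h ?_
    rintro ⟨-, rfl⟩
    omega

end AllRounds

/-! ### Average weight over the coins for a fixed shift -/

section AverageWeight

variable {d : ℕ} {X : Finset (EuclideanSpace ℝ (Fin d))} {Cs : ℝ} {p : Params}
  {sp : ℕ → Set X → SimpleGraph X} (ch : Choices X) (a : Fin d → ℝ)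
  (hsp : ∀ j Y, IsTwoHopSpanner Cs (2 ^ j) Y (sp j Y))

/-- The number of components of the spanner graph at level `2 ^ j`, minus one. -/
def spannerExcess (p : Params) (sp : ℕ → Set X → SimpleGraph X) (a : Fin d → ℝ) (j : ℕ) : ℕ :=
  Nat.card (Quotient (spannerGraph p sp a j).reachableSetoid) - 1

/-- The number of nonempty cells of side `α ^ k / β`, minus one. -/
def cellExcess (p : Params) (X : Finset (EuclideanSpace ℝ (Fin d))) (a : Fin d → ℝ) (k : ℕ) : ℕ :=
  Nat.card (Quotient (cellPartition X a (p.side k))) - 1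

theorem reachable_le_of_adj {V : Type*} {G : SimpleGraph V} {S : Setoid V}
    (h : ∀ x y, G.Adj x y → S x y) : G.reachableSetoid ≤ S := by
  rintro x y ⟨w⟩
  induction w with
  | nil => exact S.refl' _
  | cons hadj _ ih => exact S.trans' (h _ _ hadj) ih

include hsp

open Classical in
theorem average_weight_le [Nonempty X] (hCs : 0 ≤ Cs) (hg : 1 ≤ p.g)
    (hd : 2 * (d : ℝ) ≤ p.β) :
    (∑ ω : Coins X p, weight (outputEdges p sp ch a ω)) / Fintype.card (Coins X p) ≤
      ∑ j ∈ Finset.Icc 1 p.top,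
        (Cs * 2 ^ j * spannerExcess p sp a (j - 1) +
          d * p.side (p.idx j + 1) * (4 * (3 / 4) ^ p.h * cellExcess p X a (p.idx j - 1))) := by
  classical
  have hN : (0 : ℝ) < Fintype.card (Coins X p) := by exact_mod_cast Fintype.card_pos
  rw [div_le_iff₀ hN]
  have h1 : ∀ ω : Coins X p, weight (outputEdges p sp ch a ω) ≤
      ∑ j ∈ Finset.Icc 1 p.top, weight (levelEdges p sp ch a ω j) :=
    fun ω => weight_biUnion_le _ _
  refine (Finset.sum_le_sum fun ω _ => h1 ω).trans ?_
  rw [Finset.sum_comm, Finset.sum_mul]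
  refine Finset.sum_le_sum fun j hj => ?_
  obtain ⟨hj1, hj2⟩ := Finset.mem_Icc.mp hj
  refine (Finset.sum_le_sum fun ω _ =>
    weight_levelEdges_le ch a ω hsp hCs hj1 hg hd).trans ?_
  rw [Finset.sum_add_distrib, ← Finset.mul_sum, ← Finset.mul_sum, Finset.sum_add_distrib, add_mul]
  have hj3 : j < p.top + 1 := by omega
  refine add_le_add ?_ ?_
  · rw [mul_assoc (Cs * 2 ^ j)]
    refine mul_le_mul_of_nonneg_left ?_ (by positivity)
    have h2 : ∀ ω ∈ (Finset.univ : Finset (Coins X p)),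
        (hatCard ch a ω sp (j - 1) : ℝ) - 1 ≤ spannerExcess p sp a (j - 1) := by
      intro ω _
      have h3 : hatCard ch a ω sp (j - 1) ≤
          Nat.card (Quotient (spannerGraph p sp a (j - 1)).reachableSetoid) :=
        card_quotient_le_of_le (reachable_le_of_adj fun x y h => hatPartition_of_adj ch a ω hsp h)
      rw [sub_le_iff_le_add]
      exact_mod_cast (by unfold spannerExcess; omega)
    have := Finset.sum_le_card_nsmul _ _ _ h2
    rw [nsmul_eq_mul, Finset.card_univ, mul_comm] at this
    exact this
  · rw [mul_assoc (d * p.side (p.idx j + 1))]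
    refine mul_le_mul_of_nonneg_left ?_ (mul_nonneg (Nat.cast_nonneg _) (p.side_pos _).le)
    -- Two phases, each starting with at most twice the cell excess of incomplete parts, give the
    -- factor 4.
    have hE := sum_incompleteLeaders_le_card sp ch a .edges ⟨j, hj3⟩
      (fun ω => hatPartition p sp ch a ω (j - 1))
      (fun ω ω' h => hatPartition_congr_edges sp ch a h (j - 1)) _
      (fun ω => cellPartition_le_hatPartition_pred ch a ω hsp hj1)
    have hC := sum_incompleteLeaders_le_card sp ch a .components ⟨j, hj3⟩
      (fun ω => startPartition ch a ω sp j)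
      (fun ω ω' h => startPartition_congr_components sp ch a h) _
      (fun ω => cellPartition_le_startPartition ch a ω hsp hj1)
    unfold cellExcess
    calc _ ≤ _ := add_le_add hE hC
      _ = _ := by ring

end AverageWeight

open MeasureTheory

/-! ### Probability that a pair of points is cut by the random grid -/

section Shift

theorem volume_floor_ne_le {Δ L u v : ℝ} (hL : 0 < L) (hu : 0 ≤ u)
    (huv : u ≤ v) (hv : v ≤ Δ) :
    volume (Set.Ico 0 Δ ∩ {t : ℝ | ⌊(u + t) / L⌋ ≠ ⌊(v + t) / L⌋}) ≤
      ENNReal.ofReal (2 * Δ / L * (v - u)) := by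
  set N := ⌊2 * Δ / L⌋₊
  have hΔ : 0 ≤ Δ := hu.trans (huv.trans hv)
  -- Some grid line `c * L` separates `u + t` from `v + t`. Both lie in `[0, 2 * Δ)`, so `1 ≤ c ≤ 2
  -- * Δ / L`; each `c` accounts for an interval of length `v - u`.
  have hsub : Set.Ico 0 Δ ∩ {t : ℝ | ⌊(u + t) / L⌋ ≠ ⌊(v + t) / L⌋} ⊆
      ⋃ c ∈ Finset.Icc 1 N, Set.Ico ((c : ℝ) * L - v) (c * L - u) := by
    rintro t ⟨⟨ht0, ht1⟩, hne⟩
    have hle : ⌊(u + t) / L⌋ ≤ ⌊(v + t) / L⌋ := by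
      apply Int.floor_le_floor
      gcongr
    have hlt := lt_of_le_of_ne hle hne
    have hnn : 0 ≤ ⌊(u + t) / L⌋ := Int.floor_nonneg.mpr (by positivity)
    obtain ⟨c, hc⟩ := Int.eq_ofNat_of_zero_le (hnn.trans hle)
    rw [hc] at hlt
    have h1 : (u + t) / L < c := by
      have := Int.floor_lt.mp hlt
      exact_mod_cast this
    have h2 : (c : ℝ) ≤ (v + t) / L := by
      have := Int.floor_le ((v + t) / L)
      rw [hc] at this
      exact_mod_cast this
    rw [div_lt_iff₀ hL] at h1
    have h3 : (c : ℝ) ≤ 2 * Δ / L := h2.trans (by gcongr; linarith)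
    rw [le_div_iff₀ hL] at h2
    simp only [Set.mem_iUnion]
    refine ⟨c, Finset.mem_Icc.mpr ⟨?_, Nat.le_floor h3⟩, by linarith, by linarith⟩
    omega
  refine (measure_mono hsub).trans ((measure_biUnion_finset_le _ _).trans ?_)
  have hvol : ∀ c ∈ Finset.Icc 1 N, volume (Set.Ico ((c : ℝ) * L - v) (c * L - u)) =
      ENNReal.ofReal (v - u) := by
    intro c _
    rw [Real.volume_Ico]
    congr 1
    ring
  rw [Finset.sum_congr rfl hvol, Finset.sum_const, Nat.card_Icc, Nat.add_sub_cancel, nsmul_eq_mul,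
    ENNReal.ofReal_mul (by positivity), ← ENNReal.ofReal_natCast]
  gcongr
  exact Nat.floor_le (by positivity)

theorem cond_floor_ne_le {Δ L u v : ℝ} (hΔ : 0 < Δ) (hL : 0 < L) (hu : u ∈ Set.Icc 0 Δ)
    (hv : v ∈ Set.Icc 0 Δ) :
    ProbabilityTheory.cond volume (Set.Ico (0 : ℝ) Δ) {t : ℝ | ⌊(u + t) / L⌋ ≠ ⌊(v + t) / L⌋} ≤
      ENNReal.ofReal (2 * |u - v| / L) := by
  wlog huv : u ≤ v generalizing u v
  · have := this hv hu (not_le.mp huv).le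
    rw [abs_sub_comm] at this
    simpa only [ne_comm] using this
  rw [ProbabilityTheory.cond_apply measurableSet_Ico, Real.volume_Ico, sub_zero]
  calc _ ≤ (ENNReal.ofReal Δ)⁻¹ * ENNReal.ofReal (2 * Δ / L * (v - u)) := by
        gcongr
        exact volume_floor_ne_le hL hu.1 huv hv.2
    _ = _ := by
        rw [← ENNReal.ofReal_inv_of_pos hΔ, ← ENNReal.ofReal_mul (by positivity), abs_sub_comm,
          abs_of_nonneg (sub_nonneg.mpr huv)]
        congr 1
        field_simp

variable {d : ℕ} {X : Finset (EuclideanSpace ℝ (Fin d))}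

theorem isProbabilityMeasure_shiftLaw {Δ : ℝ} (hΔ : 0 < Δ) :
    IsProbabilityMeasure (shiftLaw d Δ) := by
  have : IsProbabilityMeasure (ProbabilityTheory.cond volume (Set.Ico (0 : ℝ) Δ)) :=
    ProbabilityTheory.cond_isProbabilityMeasure_of_finite (by simp [hΔ]) (by simp)
  unfold shiftLaw
  infer_instance

theorem measurable_cellIdx (L : ℝ) (x : EuclideanSpace ℝ (Fin d)) :
    Measurable fun a : Fin d → ℝ => cellIdx a L x := by
  refine measurable_pi_lambda _ fun i => ?_
  have h : Measurable fun a : Fin d → ℝ => (x i + a i) / L := by fun_prop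
  exact Int.measurable_floor.comp h

/-- Union bound over the coordinates, bounding every coordinate difference by the distance. The
factor `d` is later absorbed as polylogarithmic. -/
theorem shiftLaw_cellIdx_ne_le {Δ L : ℝ} (hΔ : 0 < Δ) (hL : 0 < L)
    {x y : EuclideanSpace ℝ (Fin d)} (hx : ∀ i, x i ∈ Set.Icc 0 Δ)
    (hy : ∀ i, y i ∈ Set.Icc 0 Δ) :
    shiftLaw d Δ {a | cellIdx a L x ≠ cellIdx a L y} ≤
      ENNReal.ofReal (2 * d * dist x y / L) := by
  have : IsProbabilityMeasure (ProbabilityTheory.cond volume (Set.Ico (0 : ℝ) Δ)) :=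
    ProbabilityTheory.cond_isProbabilityMeasure_of_finite (by simp [hΔ]) (by simp)
  set S : Fin d → Set ℝ := fun i => {t : ℝ | ⌊(x i + t) / L⌋ ≠ ⌊(y i + t) / L⌋} with hS
  have hmeas : ∀ i, MeasurableSet (S i) := by
    intro i
    have h : ∀ w : ℝ, Measurable fun t : ℝ => ⌊(w + t) / L⌋ := fun w =>
      Int.measurable_floor.comp ((measurable_id.const_add w).div_const L)
    exact (measurableSet_eq_fun (h _) (h _)).compl
  have hsub : {a | cellIdx a L x ≠ cellIdx a L y} ⊆ ⋃ i, (fun a : Fin d → ℝ => a i) ⁻¹' S i := by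
    intro a ha
    obtain ⟨i, hi⟩ := Function.ne_iff.mp ha
    exact Set.mem_iUnion.mpr ⟨i, hi⟩
  refine (measure_mono hsub).trans ((measure_iUnion_fintype_le _ _).trans ?_)
  have hone : ∀ i ∈ (Finset.univ : Finset (Fin d)),
      shiftLaw d Δ ((fun a : Fin d → ℝ => a i) ⁻¹' S i) ≤
        ENNReal.ofReal (2 * dist x y / L) := by
    intro i _
    unfold shiftLaw
    rw [(measurePreserving_eval (fun _ : Fin d =>
      ProbabilityTheory.cond volume (Set.Ico (0 : ℝ) Δ)) i).measure_preimage
      (hmeas i).nullMeasurableSet]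
    refine (cond_floor_ne_le hΔ hL (hx i) (hy i)).trans (ENNReal.ofReal_le_ofReal ?_)
    gcongr
    exact abs_coord_sub_le_dist x y i
  refine (Finset.sum_le_card_nsmul _ _ _ hone).trans (le_of_eq ?_)
  rw [Finset.card_univ, Fintype.card_fin, nsmul_eq_mul, ← ENNReal.ofReal_natCast,
    ← ENNReal.ofReal_mul (by positivity)]
  congr 1
  ring

/-- The edge `e` joins two different cells of side `L`. -/
def IsCut (a : Fin d → ℝ) (L : ℝ) (e : Sym2 X) : Prop :=
  ¬ (e.map fun x : X => cellIdx a L x).IsDiag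

open Classical in
/-- The indicator of the event that `e` is cut. -/
def cutInd (L : ℝ) (e : Sym2 X) (a : Fin d → ℝ) : ℝ := if IsCut a L e then 1 else 0

theorem measurableSet_isCut (L : ℝ) (e : Sym2 X) : MeasurableSet {a | IsCut a L e} := by
  induction e using Sym2.ind with
  | _ x y =>
    exact (measurableSet_eq_fun (measurable_cellIdx L x.1) (measurable_cellIdx L y.1)).compl

theorem cutInd_eq_indicator (L : ℝ) (e : Sym2 X) :
    cutInd L e = Set.indicator {a | IsCut a L e} fun _ => (1 : ℝ) := by
  classical
  funext a
  simp [cutInd, Set.indicator_apply]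

theorem integrable_cutInd {Δ : ℝ} (hΔ : 0 < Δ) (L : ℝ) (e : Sym2 X) :
    Integrable (cutInd L e) (shiftLaw d Δ) := by
  have := isProbabilityMeasure_shiftLaw (d := d) hΔ
  rw [cutInd_eq_indicator]
  exact (integrable_const 1).indicator (measurableSet_isCut L e)

theorem integral_cutInd_le {Δ L : ℝ} (hΔ : 0 < Δ) (hL : 0 < L)
    (hX : ∀ x ∈ X, ∀ i, x i ∈ Set.Icc (0 : ℝ) Δ) (e : Sym2 X) :
    ∫ a, cutInd L e a ∂(shiftLaw d Δ) ≤ 2 * d * edgeLen e / L := by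
  rw [cutInd_eq_indicator, integral_indicator_const _ (measurableSet_isCut L e), smul_eq_mul,
    mul_one]
  have := edgeLen_nonneg e
  refine ENNReal.toReal_le_of_le_ofReal (by positivity) ?_
  induction e using Sym2.ind with
  | _ x y => exact shiftLaw_cellIdx_ne_le hΔ hL (hX x x.2) (hX y y.2)

end Shift

/-! ### Comparison of the excesses with a spanning tree -/

section Excess

variable {d : ℕ} {X : Finset (EuclideanSpace ℝ (Fin d))} {Cs : ℝ} {p : Params}
  {sp : ℕ → Set X → SimpleGraph X} {T : SimpleGraph X} (hT : T.Connected) (a : Fin d → ℝ)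
include hT

open Classical in
theorem cellExcess_le (k : ℕ) :
    (cellExcess p X a k : ℝ) ≤ ∑ e ∈ T.edgeFinset, cutInd (p.side k) e a := by
  have h := card_quotient_le_ncard_crossing hT (cellPartition X a (p.side k))
  have h2 : (cellExcess p X a k : ℝ) ≤
      ({e | e ∈ T.edgeSet ∧ ¬ e.map (Quotient.mk (cellPartition X a (p.side k))) ∈
        Sym2.diagSet}.ncard : ℝ) := by
    exact_mod_cast (by unfold cellExcess; omega)
  refine h2.trans (le_of_eq ?_)
  simp only [cutInd]
  rw [Finset.sum_boole, Set.ncard_eq_toFinset_card']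
  congr 2
  ext e
  simp only [Set.mem_toFinset, Set.mem_ofPred_eq, Finset.mem_filter, SimpleGraph.mem_edgeFinset]
  refine and_congr_right fun _ => not_congr ?_
  induction e using Sym2.ind with
  | _ x y => exact Quotient.eq (r := cellPartition X a (p.side k))

open Classical in
theorem spannerExcess_le (hsp : ∀ j Y, IsTwoHopSpanner Cs (2 ^ j) Y (sp j Y)) (j : ℕ) :
    (spannerExcess p sp a j : ℝ) ≤ ∑ e ∈ T.edgeFinset,
      ((if (2 : ℝ) ^ j < edgeLen e then 1 else 0) + cutInd (p.side (p.idx j + 1)) e a) := by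
  set S := (spannerGraph p sp a j).reachableSetoid with hS
  have h := card_quotient_le_ncard_crossing hT S
  have h2 : (spannerExcess p sp a j : ℝ) ≤
      ({e | e ∈ T.edgeSet ∧ ¬ e.map (Quotient.mk S) ∈ Sym2.diagSet}.ncard : ℝ) := by
    have h3 : spannerExcess p sp a j = Nat.card (Quotient S) - 1 := rfl
    exact_mod_cast (by omega)
  refine h2.trans ?_
  rw [Set.ncard_eq_toFinset_card', Finset.card_eq_sum_ones]
  push_cast
  have hsub : {e | e ∈ T.edgeSet ∧ ¬ e.map (Quotient.mk S) ∈ Sym2.diagSet}.toFinset ⊆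
      T.edgeFinset := by
    intro e he
    simpa using (Set.mem_toFinset.mp he).1
  have hnn : ∀ e : Sym2 X, (0 : ℝ) ≤
      (if (2 : ℝ) ^ j < edgeLen e then 1 else 0) + cutInd (p.side (p.idx j + 1)) e a := by
    intro e
    unfold cutInd
    positivity
  refine (Finset.sum_le_sum fun e he => ?_).trans
    (Finset.sum_le_sum_of_subset_of_nonneg hsub fun e _ _ => hnn e)
  have he := (Set.mem_toFinset.mp he).2
  -- A crossing edge that is not long must be cut, since otherwise the spanner of its cell connects
  -- its ends.
  by_cases h1 : (2 : ℝ) ^ j < edgeLen e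
  · rw [if_pos h1]
    unfold cutInd
    split_ifs <;> norm_num
  · rw [if_neg h1, cutInd, if_pos, zero_add]
    intro hc
    apply he
    induction e using Sym2.ind with
    | _ x y =>
      exact Quotient.sound (spannerGraph_rel_of_close hsp hc (not_lt.mp h1)
        fun u v huv => SimpleGraph.Adj.reachable huv)

end Excess

/-! ### The expected weight -/

section Expected

theorem sum_two_pow_ite_lt_le {ℓ : ℝ} (hℓ : 0 ≤ ℓ) (m : ℕ) :
    ∑ j ∈ Finset.Icc 1 m, (2 : ℝ) ^ j * (if (2 : ℝ) ^ (j - 1) < ℓ then 1 else 0) ≤ 4 * ℓ := by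
  -- The second bound makes the induction close: when `2 ^ m < ℓ`, the new partial sum is at most `4
  -- * 2 ^ m`.
  have key : ∀ m : ℕ, ∑ j ∈ Finset.Icc 1 m,
      (2 : ℝ) ^ j * (if (2 : ℝ) ^ (j - 1) < ℓ then 1 else 0) ≤ min (4 * ℓ) (2 * 2 ^ m) := by
    intro m
    induction m with
    | zero => simp [hℓ]
    | succ m ih =>
      rw [Finset.sum_Icc_succ_top (by omega), Nat.add_sub_cancel]
      rw [le_min_iff] at ih ⊢
      have : (0 : ℝ) < 2 ^ m := by positivity
      rw [pow_succ]
      split_ifs with h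
      · constructor <;> linarith
      · constructor <;> linarith
  exact (key m).trans (min_le_left _ _)

variable {d : ℕ} {X : Finset (EuclideanSpace ℝ (Fin d))} {Cs : ℝ} {p : Params}

theorem weight_eq_sum_toFinset (E : Set (Sym2 X)) [Fintype E] :
    weight E = ∑ e ∈ E.toFinset, edgeLen e := by
  classical
  simp only [weight]
  rw [← Finset.sum_filter]
  congr 1
  ext e
  simp

/-- The three summands come from long tree edges, tree edges cut by the spanner grid, and stars. -/
theorem expectedWeight_le_of_tree [Nonempty X] {Δ : ℝ} (hΔ : 0 < Δ)
    (hX : ∀ x ∈ X, ∀ i, x i ∈ Set.Icc (0 : ℝ) Δ) (hCs : 0 ≤ Cs) (hg : 1 ≤ p.g)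
    (hd : 2 * (d : ℝ) ≤ p.β) (sp : (Fin d → ℝ) → ℕ → Set X → SimpleGraph X)
    (ch : (Fin d → ℝ) → Choices X)
    (hsp : ∀ a j Y, IsTwoHopSpanner Cs (2 ^ j) Y (sp a j Y))
    {T : SimpleGraph X} (hT : T.Connected) :
    expectedWeight p Δ sp ch ≤ ENNReal.ofReal
      ((4 * Cs + 4 * Cs * (p.top * d * (p.β / p.α)) +
        8 * p.top * d ^ 2 * p.α ^ 2 * (3 / 4) ^ p.h) * weight T.edgeSet) := by
  classical
  have hprob := isProbabilityMeasure_shiftLaw (d := d) hΔ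
  set F := T.edgeFinset with hF
  set near : ℕ → (Fin d → ℝ) → ℝ := fun j a => ∑ e ∈ F,
    ((if (2 : ℝ) ^ (j - 1) < edgeLen e then 1 else 0) +
      cutInd (p.side (p.idx (j - 1) + 1)) e a) with hnear
  set far : ℕ → (Fin d → ℝ) → ℝ := fun j a => ∑ e ∈ F, cutInd (p.side (p.idx j - 1)) e a with hfar
  set B : (Fin d → ℝ) → ℝ := fun a => ∑ j ∈ Finset.Icc 1 p.top,
    (Cs * 2 ^ j * near j a + d * p.side (p.idx j + 1) * (4 * (3 / 4) ^ p.h) * far j a) with hB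
  have hcut0 : ∀ L (e : Sym2 X) a, 0 ≤ cutInd L e a := by
    intro L e a
    unfold cutInd
    positivity
  have hnear0 : ∀ j a, 0 ≤ near j a := fun j a =>
    Finset.sum_nonneg fun e _ => add_nonneg (by positivity) (hcut0 _ _ _)
  have hfar0 : ∀ j a, 0 ≤ far j a := fun j a => Finset.sum_nonneg fun e _ => hcut0 _ _ _
  have hside := p.side_pos
  have hB0 : ∀ a, 0 ≤ B a := fun a => Finset.sum_nonneg fun j _ =>
    add_nonneg (mul_nonneg (by positivity) (hnear0 j a))
      (mul_nonneg (mul_nonneg (mul_nonneg (Nat.cast_nonneg _) (hside _).le) (by positivity))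
        (hfar0 j a))
  have hnearI : ∀ j, Integrable (near j) (shiftLaw d Δ) := fun j =>
    integrable_finsetSum _ fun e _ => (integrable_const _).add (integrable_cutInd hΔ _ e)
  have hfarI : ∀ j, Integrable (far j) (shiftLaw d Δ) := fun j =>
    integrable_finsetSum _ fun e _ => integrable_cutInd hΔ _ e
  have hBI : Integrable B (shiftLaw d Δ) := integrable_finsetSum _ fun j _ =>
    ((hnearI j).const_mul _).add ((hfarI j).const_mul _)
  -- The choices may depend on `a` non-measurably. The bound `B` depends only on the grid and on
  -- `T`, so it is integrable, and monotonicity of the lower integral needs no measurability.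
  have hle : expectedWeight p Δ sp ch ≤ ∫⁻ a, ENNReal.ofReal (B a) ∂(shiftLaw d Δ) := by
    unfold expectedWeight
    refine lintegral_mono fun a => ENNReal.ofReal_le_ofReal ?_
    refine (average_weight_le (ch a) a (hsp a) hCs hg hd).trans (Finset.sum_le_sum fun j _ => ?_)
    refine add_le_add ?_ ?_
    · exact mul_le_mul_of_nonneg_left (spannerExcess_le hT a (hsp a) (j - 1)) (by positivity)
    · rw [← mul_assoc]
      exact mul_le_mul_of_nonneg_left (cellExcess_le hT a _)
        (mul_nonneg (mul_nonneg (Nat.cast_nonneg _) (hside _).le) (by positivity))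
  refine hle.trans ?_
  rw [← ofReal_integral_eq_lintegral_ofReal hBI (Filter.Eventually.of_forall hB0)]
  refine ENNReal.ofReal_le_ofReal ?_
  have hnear_int : ∀ j, ∫ a, near j a ∂(shiftLaw d Δ) ≤ ∑ e ∈ F,
      ((if (2 : ℝ) ^ (j - 1) < edgeLen e then 1 else 0) +
        2 * d * edgeLen e / p.side (p.idx (j - 1) + 1)) := by
    intro j
    have hI : ∀ e ∈ F, Integrable (fun a => (if (2 : ℝ) ^ (j - 1) < edgeLen e then 1 else 0) +
        cutInd (p.side (p.idx (j - 1) + 1)) e a) (shiftLaw d Δ) :=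
      fun e _ => (integrable_const _).add (integrable_cutInd hΔ _ e)
    rw [integral_finsetSum _ hI]
    refine Finset.sum_le_sum fun e _ => ?_
    rw [integral_add (integrable_const _) (integrable_cutInd hΔ _ e)]
    refine add_le_add (by simp) (integral_cutInd_le hΔ (hside _) hX e)
  have hfar_int : ∀ j, ∫ a, far j a ∂(shiftLaw d Δ) ≤
      ∑ e ∈ F, 2 * d * edgeLen e / p.side (p.idx j - 1) := by
    intro j
    rw [integral_finsetSum _ fun e _ => integrable_cutInd hΔ _ e]
    exact Finset.sum_le_sum fun e _ => integral_cutInd_le hΔ (hside _) hX e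
  have hα := p.α_pos
  have hβ := p.β_pos
  have hI : ∀ j ∈ Finset.Icc 1 p.top, Integrable (fun a => Cs * 2 ^ j * near j a +
      d * p.side (p.idx j + 1) * (4 * (3 / 4) ^ p.h) * far j a) (shiftLaw d Δ) :=
    fun j _ => ((hnearI j).const_mul _).add ((hfarI j).const_mul _)
  rw [integral_finsetSum _ hI]
  have hterm : ∀ j ∈ Finset.Icc 1 p.top,
      ∫ a, (Cs * 2 ^ j * near j a + d * p.side (p.idx j + 1) * (4 * (3 / 4) ^ p.h) * far j a)
        ∂(shiftLaw d Δ) ≤ ∑ e ∈ F,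
          (Cs * (2 ^ j * (if (2 : ℝ) ^ (j - 1) < edgeLen e then 1 else 0)) +
          (4 * Cs * (d * (p.β / p.α)) + 8 * d ^ 2 * p.α ^ 2 * (3 / 4) ^ p.h) * edgeLen e) := by
    intro j hj
    have hj1 := (Finset.mem_Icc.mp hj).1
    rw [integral_add ((hnearI j).const_mul _) ((hfarI j).const_mul _), integral_const_mul,
      integral_const_mul]
    refine (add_le_add (mul_le_mul_of_nonneg_left (hnear_int j) (by positivity))
      (mul_le_mul_of_nonneg_left (hfar_int j)
        (mul_nonneg (mul_nonneg (Nat.cast_nonneg _) (hside _).le) (by positivity)))).trans ?_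
    rw [Finset.mul_sum, Finset.mul_sum, ← Finset.sum_add_distrib]
    refine Finset.sum_le_sum fun e _ => ?_
    have hℓ := edgeLen_nonneg e
    have h1 : (2 : ℝ) ^ j / p.side (p.idx (j - 1) + 1) ≤ 2 * (p.β / p.α) := by
      have h2 : (2 : ℝ) ^ j = 2 * 2 ^ (j - 1) := by
        rw [← pow_succ', Nat.sub_add_cancel hj1]
      have h3 := p.two_pow_le_α_pow_idx (j - 1)
      rw [h2, Params.side, pow_succ, div_div_eq_mul_div, div_le_iff₀ (by positivity)]
      calc 2 * 2 ^ (j - 1) * p.β ≤ 2 * p.α ^ p.idx (j - 1) * p.β := by gcongr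
        _ = _ := by field_simp
    -- Star lengths and starting cells are two grid scales apart; the price `α ^ 2` is paid by `(3 /
    -- 4) ^ h`.
    have h4 : p.side (p.idx j + 1) / p.side (p.idx j - 1) = p.α ^ 2 := by
      obtain ⟨k, hk⟩ := Nat.exists_eq_add_of_le (p.idx_pred_mul_lt hj1).1
      rw [hk, show 1 + k + 1 = k + 2 by ring, show 1 + k - 1 = k by omega, Params.side,
        Params.side, pow_add]
      field_simp
    calc _ = Cs * (2 ^ j * (if (2 : ℝ) ^ (j - 1) < edgeLen e then 1 else 0)) +
          (2 * Cs * d * (2 ^ j / p.side (p.idx (j - 1) + 1)) +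
            8 * d ^ 2 * (p.side (p.idx j + 1) / p.side (p.idx j - 1)) * (3 / 4) ^ p.h) *
            edgeLen e := by ring
      _ ≤ Cs * (2 ^ j * (if (2 : ℝ) ^ (j - 1) < edgeLen e then 1 else 0)) +
          (2 * Cs * d * (2 * (p.β / p.α)) +
            8 * d ^ 2 * p.α ^ 2 * (3 / 4) ^ p.h) * edgeLen e := by
          rw [h4]
          gcongr
      _ = _ := by ring
  refine (Finset.sum_le_sum hterm).trans ?_
  rw [Finset.sum_comm, weight_eq_sum_toFinset, Finset.mul_sum]
  refine Finset.sum_le_sum fun e _ => ?_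
  rw [Finset.sum_add_distrib, ← Finset.mul_sum, Finset.sum_const, Nat.card_Icc,
    Nat.add_sub_cancel, nsmul_eq_mul]
  have := mul_le_mul_of_nonneg_left (sum_two_pow_ite_lt_le (edgeLen_nonneg e) p.top) hCs
  linarith

theorem exists_tree_weight_eq_mst (hX : X.Nonempty) :
    ∃ T : SimpleGraph X, T.IsTree ∧ weight T.edgeSet = mst X := by
  have : Nonempty X := hX.to_subtype
  obtain ⟨T₀, -, hT₀⟩ := (SimpleGraph.connected_top (V := X)).exists_isTree_le
  have hne : (weight '' {E : Set (Sym2 X) | IsSpanningTree E}).Nonempty :=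
    ⟨_, T₀.edgeSet, ⟨T₀, hT₀, rfl⟩, rfl⟩
  obtain ⟨E, ⟨T, hT, rfl⟩, hE⟩ := hne.csInf_mem (Set.toFinite _)
  exact ⟨T, hT, hE⟩

end Expected

/-! ### Polylogarithmic parameters -/

section Numerics

variable {p : Params} {d : ℕ} {x Kd Kα KH : ℝ}

/-- Here `x` stands for `log n`. Since `2 ^ g * log 2 = log α`, this makes the number of levels
polynomial in `log n`. -/
theorem Params.two_pow_g_le (hx : 3 ≤ x) (hKα : 1 ≤ Kα) (hα : p.α ≤ x ^ Kα) :
    (2 : ℝ) ^ p.g ≤ 2 * Kα * x := by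
  have hx0 : 0 < x := by linarith
  have h1 := Real.log_le_log p.α_pos hα
  rw [Real.log_rpow hx0, Params.α, Real.log_pow] at h1
  push_cast at h1
  have h2 : Real.log x ≤ x := (Real.log_le_sub_one_of_pos hx0).trans (by linarith)
  have h3 : (1 : ℝ) / 2 ≤ Real.log 2 := by linarith [Real.log_two_gt_d9]
  have h4 : (0 : ℝ) < 2 ^ p.g := by positivity
  nlinarith

theorem Params.top_le (hx : 3 ≤ x) (hKα : 1 ≤ Kα) (hKH : 1 ≤ KH) (hα : p.α ≤ x ^ Kα)
    (hH : (p.H : ℝ) ≤ KH * x) : (p.top : ℝ) ≤ 2 * KH * Kα * x ^ 2 := by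
  have h1 := Params.two_pow_g_le hx hKα hα
  rw [Params.top]
  push_cast
  calc (p.H : ℝ) * 2 ^ p.g ≤ (KH * x) * (2 * Kα * x) := by gcongr
    _ = _ := by ring

theorem three_quarters_pow_le {c : ℝ} {h : ℕ} (hx : 0 < x)
    (hh : 4 * c * Real.log x ≤ h) : (3 / 4 : ℝ) ^ h ≤ (x ^ c)⁻¹ := by
  have h1 : Real.log (3 / 4) ≤ -(1 / 4) := by
    have := Real.log_le_sub_one_of_pos (show (0 : ℝ) < 3 / 4 by norm_num)
    linarith
  rw [← Real.rpow_natCast, Real.rpow_def_of_pos (by norm_num), ← Real.rpow_neg hx.le,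
    Real.rpow_def_of_pos hx, Real.exp_le_exp]
  have : (0 : ℝ) ≤ h := Nat.cast_nonneg h
  nlinarith

theorem Params.star_term_le (hx : 3 ≤ x) (hKd : 1 ≤ Kd) (hKα : 1 ≤ Kα) (hKH : 1 ≤ KH)
    (hxK : 16 * KH * Kα * Kd ^ 2 ≤ x) (hd : (d : ℝ) ≤ Kd * x)
    (hα : p.α ≤ x ^ Kα) (hH : (p.H : ℝ) ≤ KH * x)
    (hh : 4 * (5 + 2 * Kα) * Real.log x ≤ p.h) :
    8 * p.top * d ^ 2 * p.α ^ 2 * (3 / 4) ^ p.h ≤ 1 := by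
  have hx0 : 0 < x := by linarith
  have hα0 := p.α_pos
  have h1 := Params.top_le hx hKα hKH hα hH
  have h2 := three_quarters_pow_le hx0 hh
  have h3 : p.α ^ 2 ≤ x ^ (2 * Kα) := by
    rw [mul_comm, Real.rpow_mul hx0.le]
    exact_mod_cast pow_le_pow_left₀ hα0.le hα 2
  have h4 : x ^ (5 + 2 * Kα) = x ^ 5 * x ^ (2 * Kα) := by
    rw [Real.rpow_add hx0]
    congr 1
    exact_mod_cast Real.rpow_natCast x 5
  have h5 : 0 < x ^ (5 + 2 * Kα) := Real.rpow_pos_of_pos hx0 _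
  calc 8 * p.top * d ^ 2 * p.α ^ 2 * (3 / 4) ^ p.h
      ≤ 8 * (2 * KH * Kα * x ^ 2) * (Kd * x) ^ 2 * x ^ (2 * Kα) * (x ^ (5 + 2 * Kα))⁻¹ := by
        gcongr
    _ = (16 * KH * Kα * Kd ^ 2) * x ^ 4 * x ^ (2 * Kα) * (x ^ (5 + 2 * Kα))⁻¹ := by ring
    _ ≤ x * x ^ 4 * x ^ (2 * Kα) * (x ^ (5 + 2 * Kα))⁻¹ := by gcongr
    _ = x ^ (5 + 2 * Kα) * (x ^ (5 + 2 * Kα))⁻¹ := by rw [h4]; ring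
    _ = 1 := mul_inv_cancel₀ h5.ne'

theorem Params.cut_term_le (hx : 3 ≤ x) (hKd : 1 ≤ Kd) (hKα : 1 ≤ Kα) (hKH : 1 ≤ KH)
    (hxK : 2 * KH * Kα * Kd ≤ x) (hd : (d : ℝ) ≤ Kd * x) (hβα : x ^ 4 ≤ p.α / p.β)
    (hα : p.α ≤ x ^ Kα) (hH : (p.H : ℝ) ≤ KH * x) :
    p.top * d * (p.β / p.α) ≤ 1 := by
  have hx0 : 0 < x := by linarith
  have h1 := Params.top_le hx hKα hKH hα hH
  have h2 : p.β / p.α ≤ (x ^ 4)⁻¹ := by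
    rw [← inv_div]
    exact inv_anti₀ (by positivity) hβα
  have h3 : 0 ≤ p.β / p.α := (div_pos p.β_pos p.α_pos).le
  calc p.top * d * (p.β / p.α) ≤ (2 * KH * Kα * x ^ 2) * (Kd * x) * (x ^ 4)⁻¹ := by gcongr
    _ = (2 * KH * Kα * Kd) * x ^ 3 * (x ^ 4)⁻¹ := by ring
    _ ≤ x * x ^ 3 * (x ^ 4)⁻¹ := by gcongr
    _ = 1 := by field_simp

theorem Params.one_le_g (hx : 3 ≤ x) (hβ : x ^ 4 ≤ p.β) (hβα : x ^ 4 ≤ p.α / p.β) :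
    1 ≤ p.g ∧ x ≤ p.α := by
  have hx1 : x ≤ x ^ 4 := le_self_pow₀ (by linarith) (by norm_num)
  rw [le_div_iff₀ p.β_pos] at hβα
  have h1 : x ≤ p.α := by nlinarith
  refine ⟨Nat.one_le_iff_ne_zero.mpr fun hg => ?_, h1⟩
  have : p.α = 2 := by simp [Params.α, hg]
  linarith

end Numerics

end EuclidMST

end

/-! ### Choice of constants and conclusion -/

theorem mainTheorem4 :
    ∃ C₀ : ℝ, ∀ Cs : ℝ, 1 ≤ Cs → ∃ M : ℝ, 0 < M ∧
      ∀ C Kd Kα KH : ℝ, C₀ ≤ C → ∃ c₀ : ℝ, ∃ n₀ : ℕ,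
      ∀ (d D : ℕ) (p : EuclidMST.Params) (X : Finset (EuclideanSpace ℝ (Fin d))),
        n₀ ≤ X.card →
        (d : ℝ) ≤ Kd * Real.log X.card →
        Real.log X.card ^ C ≤ p.β →
        Real.log X.card ^ C ≤ p.α / p.β →
        p.α ≤ Real.log X.card ^ Kα →
        (∀ x ∈ X, ∀ i, x i ∈ Set.Icc (0 : ℝ) (2 ^ D)) →
        (∀ x ∈ X, ∀ y ∈ X, x ≠ y → p.α ^ 100 ≤ dist x y) →
        (∀ x ∈ X, ∀ y ∈ X, dist x y ≤ p.α ^ p.H) →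
        2 * (2 : ℝ) ^ D ≤ p.α ^ (p.H + 1) / p.β →
        (p.H : ℝ) ≤ KH * Real.log X.card / Real.log (Real.log X.card) →
        c₀ * Real.log (Real.log X.card) ≤ p.h →
        ∀ (sp : (Fin d → ℝ) → ℕ → Set X → SimpleGraph X)
          (ch : (Fin d → ℝ) → EuclidMST.Choices X),
          (∀ a j Y, EuclidMST.IsTwoHopSpanner Cs (2 ^ j) Y (sp a j Y)) →
          (∀ a : Fin d → ℝ, (∀ i, a i ∈ Set.Ico (0 : ℝ) (2 ^ D)) →
            ∀ ω : EuclidMST.Coins X p,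
              EuclidMST.IsSpanningTree (EuclidMST.outputEdges p (sp a) (ch a) a ω)) ∧
          EuclidMST.expectedWeight p (2 ^ D) sp ch ≤
            ENNReal.ofReal (M * EuclidMST.mst X) := by
  -- The cut term has size `x ^ 2 * x / x ^ 4` up to constants, so exponent 4 suffices. Both error
  -- terms being at most 1, the weight factor is `4 * Cs + 4 * Cs + 1`.
  refine ⟨4, fun Cs hCs => ⟨8 * Cs + 1, by linarith, fun C Kd₀ Kα₀ KH₀ hC => ?_⟩⟩
  obtain ⟨Kd, hKd, hKd₀⟩ : ∃ K : ℝ, 1 ≤ K ∧ Kd₀ ≤ K := ⟨_, le_max_left _ _, le_max_right _ _⟩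
  obtain ⟨Kα, hKα, hKα₀⟩ : ∃ K : ℝ, 1 ≤ K ∧ Kα₀ ≤ K := ⟨_, le_max_left _ _, le_max_right _ _⟩
  obtain ⟨KH, hKH, hKH₀⟩ : ∃ K : ℝ, 1 ≤ K ∧ KH₀ ≤ K := ⟨_, le_max_left _ _, le_max_right _ _⟩
  -- This gives `(3 / 4) ^ h ≤ x ^ (-(5 + 2 * Kα))`: exponent 4 pays for `top * d ^ 2`, `2 * Kα` for
  -- `α ^ 2`, and the remaining `x` for the constants. The exponential makes `x` exceed every
  -- constant used below.
  refine ⟨4 * (5 + 2 * Kα),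
    ⌈Real.exp (3 + Cs + 16 * KH * Kα * Kd ^ 2 + 2 * KH * Kα * Kd + 2 * Kd)⌉₊, ?_⟩
  intro d D p X hn hd hβ hβα hα hX hmin hmax hΔ hH hh sp ch hsp
  have hn' := Nat.ceil_le.mp hn
  have hn0 : (0 : ℝ) < X.card := (Real.exp_pos _).trans_le hn'
  have hlog := (Real.le_log_iff_exp_le hn0).mpr hn'
  set x := Real.log X.card
  have hA : 0 ≤ 16 * KH * Kα * Kd ^ 2 := by positivity
  have hB : 0 ≤ 2 * KH * Kα * Kd := by positivity
  have hx : 3 ≤ x := by linarith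
  have hx0 : 0 < x := by linarith
  have hlx : 1 ≤ Real.log x := by
    rw [Real.le_log_iff_exp_le hx0]
    linarith [Real.exp_one_lt_d9]
  have hpow : x ^ 4 ≤ x ^ C := by
    rw [← Real.rpow_natCast]
    exact Real.rpow_le_rpow_of_exponent_le (by linarith) (by exact_mod_cast hC)
  have hβ4 := hpow.trans hβ
  have hβα4 := hpow.trans hβα
  have hα' : p.α ≤ x ^ Kα :=
    hα.trans (Real.rpow_le_rpow_of_exponent_le (by linarith) hKα₀)
  have hd' : (d : ℝ) ≤ Kd * x := hd.trans (by gcongr)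
  have hH' : (p.H : ℝ) ≤ KH * x := by
    refine hH.trans ?_
    rw [div_le_iff₀ (by linarith)]
    calc KH₀ * x ≤ KH * x * 1 := by rw [mul_one]; gcongr
      _ ≤ KH * x * Real.log x := by gcongr
  obtain ⟨hg, hxα⟩ := EuclidMST.Params.one_le_g hx hβ4 hβα4
  have hdβ : 2 * (d : ℝ) ≤ p.β := by
    refine le_trans ?_ hβ4
    have h2 : x ^ 2 ≤ x ^ 4 := pow_le_pow_right₀ (by linarith) (by norm_num)
    nlinarith
  have hne : X.Nonempty := Finset.card_pos.mp (by exact_mod_cast hn0)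
  have : Nonempty X := hne.to_subtype
  have hCs0 : 0 ≤ Cs := by linarith
  have hα100 : p.α ≤ p.α ^ 100 := le_self_pow₀ p.one_lt_α.le (by norm_num)
  constructor
  · intro a ha ω
    refine EuclidMST.isSpanningTree_outputEdges (ch a) a ω (hsp a)
      (EuclidMST.hatPartition_zero_eq_bot (ch a) a ω (hsp a) hmin ?_ (by linarith) hCs0)
      (EuclidMST.hatPartition_top_eq_top (ch a) a ω (hsp a) hX ha hΔ hmax)
    have h1 : (d : ℝ) * p.side 0 ≤ 1 := by
      rw [EuclidMST.Params.side, pow_zero, mul_one_div, div_le_one p.β_pos]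
      linarith [Nat.cast_nonneg (α := ℝ) d]
    linarith
  · obtain ⟨T, hT, hw⟩ := EuclidMST.exists_tree_weight_eq_mst hne
    refine (EuclidMST.expectedWeight_le_of_tree (by positivity) hX hCs0 hg hdβ sp ch hsp
      hT.connected).trans (ENNReal.ofReal_le_ofReal ?_)
    rw [hw]
    have hw0 : 0 ≤ EuclidMST.mst X := hw ▸ EuclidMST.weight_nonneg _
    refine mul_le_mul_of_nonneg_right ?_ hw0
    have h1 := EuclidMST.Params.cut_term_le hx hKd hKα hKH (by linarith) hd' hβα4 hα' hH'
    have h2 := EuclidMST.Params.star_term_le hx hKd hKα hKH (by linarith) hd' hα' hH' hh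
    nlinarith
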